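/- **Definitions.** Let $X$ be a CAT(0) space (not assumed complete or proper) and $L\ge 0$ an integer. *Curtains.* Let $\alpha:I\to X$ be a geodesic (an isometric embedding of a closed interval $I\subseteq\mathbb R$), with closest-point projection $\pi_\alpha:X\to\alpha(I)$, and let $r$ be such that $[r-\frac12,r+\frac12]$ lies in the interior of $I$. The associated *curtain* is $h=\pi_\alpha^{-1}\big(\alpha([r-\frac12,r+\frac12])\big)$, and its *halfspaces* are $h^-=\pi_\alpha^{-1}\big(\alpha(I\cap(-\infty,r-\frac12))\big)$ and $h^+=\pi_\alpha^{-1}\big(\alpha(I\cap(r+\frac12,\infty))\big)$. The curtain $h$ *separates* $A\subseteq X$ from $B\subseteq X$ if one of them lies in $h^-$ and the other in $h^+$. *Chains.* A *chain* is a sequence $h_1,\dots,h_n$ of pairwise disjoint curtains such that $h_i$ separates $h_{i-1}$ from $h_{i+1}$ whenever $1<i<n$. Two disjoint curtains $h,k$ are *$L$-separated* if every chain all of whose elements meet both $h$ and $k$ has at most $L$ elements. An *$L$-chain* is a chain whose elements are pairwise $L$-separated. *The spaces $X_L$.* Put $d_L(x,x)=0$ and, for $x\ne y$, $$d_L(x,y)=1+\max\{|c|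 : c\text{ is an }L\text{-chain, every element of which separates }x\text{ from }y\}.$$ Write $X_L=(X,d_L)$. *Coarse geometry.* Let $q\ge1$. A *$q$-quasigeodesic* of a metric space $(Y,d)$ is a (not necessarily continuous) map $\gamma$ from an interval $J\subseteq\mathbb R$ to $Y$ with $\frac1q|s-t|-q\le d(\gamma(s),\gamma(t))\le q|s-t|+q$ for all $s,t\in J$. A map $\alpha:I\to Y$ from an interval is an *unparametrised $q$-quasigeodesic* if $\alpha\circ\varphi$ is a $q$-quasigeodesic for some strictly increasing bijection $\varphi:J\to I$ from an interval $J$. The space $Y$ is *quasigeodesic* if for some $q$ any two points are joined by a $q$-quasigeodesic defined on a compact interval. A quasigeodesic space $Y$ is *hyperbolic* if for every $q\ge1$ there is $\delta$ such that in every triangle whose sides are $q$-quasigeodesics (on compact intervals), each side lies in the $\delta$-neighbourhood of the union of the other two. If a group $G$ acts on $Y$ and $Z$, the action on $Y$ *dominates* the action on $Z$ if there are a $G$-equivariant map $f:Y\to Z$ and a constant $C$ with $d_Z(f(y),f(y'))\le C\,d_Y(y,y')+C$ for all $y,y'\in Y$. **Theorem.** Let $X$ be a CAT(0) space and let $L\ge0$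 be an integer. Then: 1. the maximum defining $d_L(x,y)$ exists for all $x\neq y$ in $X$, and $d_L$ is a metric on $X$; 2. $X_L$ is a quasigeodesic hyperbolic space; 3. $\operatorname{Isom}X\le\operatorname{Isom}X_L$ as groups of permutations of the set $X$; 4. if $L\ge1$, then the action of $\operatorname{Isom}X$ on $X_L$ dominates the action of $\operatorname{Isom}X$ on $X_{L-1}$; 5. there is a constant $q\ge1$ such that every geodesic $\alpha:I\to X$ of the CAT(0) space $X$, where $I\subseteq\mathbb R$ is an interval, is an unparametrised $q$-quasigeodesic of $X_L$. -/

import Mathlib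

open Set

/-- `α`, restricted to `I`, is a geodesic: `I` is an interval of the real line (bounded or not,
with or without its endpoints) and `α` is an isometric embedding of `I`. -/
def IsGeodesicOn {X : Type*} [MetricSpace X] (α : ℝ → X) (I : Set ℝ) : Prop :=
  I.OrdConnected ∧ ∀ s ∈ I, ∀ t ∈ I, dist (α s) (α t) = |s - t|

/-- A CAT(0) space: a geodesic metric space in which every geodesic triangle is at least as thin
as its comparison triangle in the Euclidean plane. In a geodesic space, the points `x` with
`dist p x + dist x q = dist p q` are exactly the points lying on geodesics from `p` to `q`.
Hence `x` and `y` range over the points of two sides, issuing from the vertex `p`, of a geodesic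
triangle with vertices `p, q, r`, and `x', y'` are their comparison points. (For two points on the
same side the comparison inequality is an equality.) -/
class CAT0Space (X : Type*) [MetricSpace X] : Prop where
  exists_geodesic : ∀ x y : X, ∃ γ : ℝ → X,
    IsGeodesicOn γ (Icc 0 (dist x y)) ∧ γ 0 = x ∧ γ (dist x y) = y
  dist_le_comparison : ∀ (p q r x y : X) (p' q' r' x' y' : EuclideanSpace ℝ (Fin 2)),
    dist p' q' = dist p q → dist p' r' = dist p r → dist q' r' = dist q r →
    dist p x + dist x q = dist p q → dist p' x' = dist p x → dist x' q' = dist x q →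
    dist p y + dist y r = dist p r → dist p' y' = dist p y → dist y' r' = dist y r →
    dist x y ≤ dist x' y'

/-- The data defining a curtain: a geodesic `α : I → X`, where `I` is a closed interval (so that
closest-point projection to `α` is defined), and a number `r` such that `[r - 1/2, r + 1/2]` lies
in the interior of `I`. The curtain itself, as a subset of `X`, is `Curtain.carrier`. -/
structure Curtain (X : Type*) [MetricSpace X] where
  /-- the domain of the geodesic -/
  I : Set ℝ
  /-- the geodesic (only its restriction to `I` matters) -/
  α : ℝ → X
  /-- the midpoint of the pole -/
  r : ℝ
  isClosed_I : IsClosed I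
  isGeodesicOn : IsGeodesicOn α I
  pole_subset : Icc (r - 1 / 2) (r + 1 / 2) ⊆ interior I

namespace Curtain

variable {X : Type*} [MetricSpace X]

/-- The set of points `x` with `π_α(x) ∈ α (I ∩ J)`, where `π_α` is the closest-point projection
to the geodesic `α`. -/
def projPreimage (h : Curtain X) (J : Set ℝ) : Set X :=
  {x | ∃ t ∈ h.I ∩ J, ∀ s ∈ h.I, dist x (h.α t) ≤ dist x (h.α s)}

/-- The curtain `π_α⁻¹ (α [r - 1/2, r + 1/2])`. -/
def carrier (h : Curtain X) : Set X := h.projPreimage (Icc (h.r - 1 / 2) (h.r + 1 / 2))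

/-- The halfspace `h⁻`. -/
def negHalf (h : Curtain X) : Set X := h.projPreimage (Iio (h.r - 1 / 2))

/-- The halfspace `h⁺`. -/
def posHalf (h : Curtain X) : Set X := h.projPreimage (Ioi (h.r + 1 / 2))

/-- `h` separates `A` from `B`: they lie in different halfspaces. Which halfspace is called `h⁻`
depends only on the direction in which the geodesic is traversed. -/
def Separates (h : Curtain X) (A B : Set X) : Prop :=
  (A ⊆ h.negHalf ∧ B ⊆ h.posHalf) ∨ (A ⊆ h.posHalf ∧ B ⊆ h.negHalf)

/-- `h` and `k` meet, as subsets of `X`. -/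
def Meets (h k : Curtain X) : Prop := (h.carrier ∩ k.carrier).Nonempty

end Curtain

section Chains

variable {X : Type*} [MetricSpace X]

/-- A chain of `n` curtains: the curtains are pairwise disjoint, and each one separates its
predecessor from its successor. -/
def IsCurtainChain {n : ℕ} (c : Fin n → Curtain X) : Prop :=
  (∀ i j : Fin n, i ≠ j → Disjoint (c i).carrier (c j).carrier) ∧
  ∀ i j k : Fin n, (i : ℕ) + 1 = j → (j : ℕ) + 1 = k →
    (c j).Separates (c i).carrier (c k).carrier

/-- Disjoint curtains `h`, `k` are `L`-separated if every chain, all of whose elements meet both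
`h` and `k`, has cardinality at most `L`. (Finite chains suffice here, since consecutive elements
of a chain form a chain.) -/
def LSeparated (L : ℕ) (h k : Curtain X) : Prop :=
  Disjoint h.carrier k.carrier ∧
  ∀ (n : ℕ) (c : Fin n → Curtain X), IsCurtainChain c →
    (∀ i, (c i).Meets h ∧ (c i).Meets k) → n ≤ L

/-- An `L`-chain: a chain whose elements are pairwise `L`-separated. -/
def IsLChain (L : ℕ) {n : ℕ} (c : Fin n → Curtain X) : Prop :=
  IsCurtainChain c ∧ ∀ i j : Fin n, i ≠ j → LSeparated L (c i) (c j)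

/-- The cardinalities of the `L`-chains that separate `x` from `y`. -/
def separatingLengths (L : ℕ) (x y : X) : Set ℕ :=
  {n | ∃ c : Fin n → Curtain X, IsLChain L c ∧ ∀ i, (c i).Separates {x} {y}}

open Classical in
/-- The curtain metric `d_L`: `d_L(x, x) = 0`, and for `x ≠ y`, `d_L(x, y)` is one plus the maximal
cardinality of an `L`-chain separating `x` from `y`. -/
noncomputable def curtainDist (L : ℕ) (x y : X) : ℝ :=
  if x = y then 0 else 1 + ((sSup (separatingLengths L x y) : ℕ) : ℝ)

end Chains

section CoarseGeometry

variable {Y : Type*}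

/-- `d` is the distance function of a metric on `Y`. -/
def IsMetric (d : Y → Y → ℝ) : Prop :=
  ∃ m : MetricSpace Y, ∀ x y, m.dist x y = d x y

/-- `γ`, restricted to the interval `J`, is a `q`-quasigeodesic of `(Y, d)`. -/
def IsQuasigeodesicOn (d : Y → Y → ℝ) (q : ℝ) (γ : ℝ → Y) (J : Set ℝ) : Prop :=
  J.OrdConnected ∧ ∀ s ∈ J, ∀ t ∈ J,
    |s - t| / q - q ≤ d (γ s) (γ t) ∧ d (γ s) (γ t) ≤ q * |s - t| + q

/-- `γ : [0, T] → Y` is a `q`-quasigeodesic from `x` to `y`. -/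
def IsQuasigeodesicFromTo (d : Y → Y → ℝ) (q : ℝ) (γ : ℝ → Y) (T : ℝ) (x y : Y) : Prop :=
  0 ≤ T ∧ IsQuasigeodesicOn d q γ (Icc 0 T) ∧ γ 0 = x ∧ γ T = y

/-- `α`, restricted to `I`, is an unparametrised `q`-quasigeodesic of `(Y, d)`: after an increasing
reparametrisation of `I` by an interval `J`, it is a `q`-quasigeodesic. -/
def IsUnparametrisedQuasigeodesicOn (d : Y → Y → ℝ) (q : ℝ) (α : ℝ → Y) (I : Set ℝ) : Prop :=
  ∃ (J : Set ℝ) (φ : ℝ → ℝ), StrictMonoOn φ J ∧ φ '' J = I ∧ IsQuasigeodesicOn d q (α ∘ φ) J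

/-- `(Y, d)` is a quasigeodesic space: for some `q`, any two points are joined by a
`q`-quasigeodesic. -/
def IsQuasigeodesicSpace (d : Y → Y → ℝ) : Prop :=
  ∃ q : ℝ, 1 ≤ q ∧ ∀ x y : Y, ∃ (γ : ℝ → Y) (T : ℝ), IsQuasigeodesicFromTo d q γ T x y

/-- Hyperbolicity of a quasigeodesic space: quasigeodesic triangles are thin. That is, for every
`q` there is `δ` such that in every triangle with `q`-quasigeodesic sides, each side lies in the
`δ`-neighbourhood of the union of the other two. (All sides are covered, by cyclic relabelling.) -/
def IsHyperbolic (d : Y → Y → ℝ) : Prop :=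
  ∀ q : ℝ, 1 ≤ q → ∃ δ : ℝ, ∀ (x y z : Y) (γ₁ γ₂ γ₃ : ℝ → Y) (T₁ T₂ T₃ : ℝ),
    IsQuasigeodesicFromTo d q γ₁ T₁ x y → IsQuasigeodesicFromTo d q γ₂ T₂ y z →
    IsQuasigeodesicFromTo d q γ₃ T₃ z x →
    ∀ s ∈ Icc 0 T₁, (∃ t ∈ Icc 0 T₂, d (γ₁ s) (γ₂ t) ≤ δ) ∨ (∃ t ∈ Icc 0 T₃, d (γ₁ s) (γ₃ t) ≤ δ)

/-- The isometry group of `(Y, d)`, as a subgroup of the group of permutations of `Y`. -/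
def isometryGroup (d : Y → Y → ℝ) : Subgroup (Equiv.Perm Y) where
  carrier := {g | ∀ x y, d (g x) (g y) = d x y}
  mul_mem' := fun {a b} ha hb x y => by
    rw [Equiv.Perm.mul_apply, Equiv.Perm.mul_apply, ha, hb]
  one_mem' := fun _ _ => rfl
  inv_mem' := fun {a} ha x y => by
    have h := ha (a⁻¹ x) (a⁻¹ y)
    simp only [Equiv.Perm.inv_def, Equiv.apply_symm_apply] at h
    exact h.symm

/-- The action of `G` on `(Y, dY)` dominates its action on `(Z, dZ)`: there is a `G`-equivariant,
coarsely Lipschitz map `Y → Z`. -/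
def ActionDominates (G : Type*) [Group G] {Z : Type*} [MulAction G Y] [MulAction G Z]
    (dY : Y → Y → ℝ) (dZ : Z → Z → ℝ) : Prop :=
  ∃ f : Y → Z, (∀ (g : G) (y : Y), f (g • y) = g • f y) ∧
    ∃ C : ℝ, ∀ y y' : Y, dZ (f y) (f y') ≤ C * dY y y' + C

end CoarseGeometry

/-! ### Convexity inequalities along CAT(0) geodesics. -/

section Geodesics

variable {X : Type*} [MetricSpace X]

/-! Orient each curtain of an `L`-chain separating `x` from `y` so that `x` lies on its negative
side. The chain then becomes a tower: curtains linearly ordered by `Curtain.Below`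
(`mem_separatingLengths`). Towers have length at most `dist x y + 2`, so the maxima exist. Inserting
a third point spoils at most one curtain of a tower, and the summand 1 in `d_L` absorbs that loss;
this is the triangle inequality. Isometries permute curtains, and `L`-separation weakens as `L`
grows, so the identity map realises the domination.

The engine for the rest is `IsClosedGeodesic.sub_le_of_lSeparated`. If two curtains both project
onto a long stretch of a geodesic `β`, then, being connected, they both meet every curtain dual to
that stretch, and these form a chain; so for `L`-separated curtains the stretch has length at most
`L + 1`. Applied to perpendiculars of a geodesic `α`, and to `α` itself, this shows that `α` cannot
backtrack through a long tower and that the two ends of the tower have well separated projections to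
`α`. Hence every block of `3 * L + 16` curtains crossed by `α` can be replaced by one curtain dual
to `α` (`IsLTower.exists_dual_curtain`).

Dual curtains on either side of a point of `α` are automatically nested, so towers can be glued
there: `d_L` is coarsely additive along CAT(0) geodesics (`IsGeodesicOn.curtainDist_add_le`). A
coarsely additive distance on an interval is coarsely the distance of an increasing coordinate,
which makes CAT(0) geodesics unparametrised quasigeodesics and `X_L` a quasigeodesic space.

For hyperbolicity, a geodesic crossing three pairwise separated dual curtains of `α` passes within
`L + 1` of `α` (`IsClosedGeodesic.dist_le_of_lSeparated`). Therefore CAT(0) triangles are thin in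
`d_L` and projections to CAT(0) geodesics are contracting. A Morse argument
(`exists_dist_le_of_contracting`) transfers thinness to all quasigeodesic triangles. -/

theorem dist_euclidean_pair (a b c d : ℝ) :
    dist (!₂[a, b] : EuclideanSpace ℝ (Fin 2)) !₂[c, d] = √((a - c) ^ 2 + (b - d) ^ 2) := by
  rw [EuclideanSpace.dist_eq, Fin.sum_univ_two]
  simp [Real.dist_eq, sq_abs]

/-- The Bruhat–Tits inequality for a point of a segment `[p, q]`, cleared of denominators. -/
theorem CAT0Space.mul_sq_dist_le [CAT0Space X] {p q r x : X}
    (h : dist p x + dist x q = dist p q) :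
    dist p q * dist x r ^ 2 ≤ dist x q * dist p r ^ 2 + dist p x * dist q r ^ 2
      - dist x q * dist p x * dist p q := by
  rcases eq_or_lt_of_le (dist_nonneg (x := p) (y := q)) with h0 | h0
  · have h1 : dist p x = 0 := by linarith [dist_nonneg (x := p) (y := x), dist_nonneg (x := x) (y := q)]
    have h2 : dist x q = 0 := by linarith
    rw [← h0, h1, h2]; simp
  set A := dist p q with hA
  set B := dist p r with hB
  set C := dist q r with hC
  set u := dist p x with hu
  set v := dist x q with hv
  have hB0 : 0 ≤ B := dist_nonneg
  have hC0 : 0 ≤ C := dist_nonneg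
  have hu0 : 0 ≤ u := dist_nonneg
  have hv0 : 0 ≤ v := dist_nonneg
  have t1 : A ≤ B + C := by
    rw [hA, hB, hC]; linarith [dist_triangle p r q, dist_comm r q]
  have t2 : B ≤ A + C := dist_triangle p q r
  have t3 : C ≤ A + B := by
    rw [hA, hB, hC]; linarith [dist_triangle q p r, dist_comm q p]
  -- The comparison triangle has `p'` at the origin and `q'` on the first axis; `b`, given by the
  -- cosine law, and `c` are the coordinates of `r'`.
  set b := (A ^ 2 + B ^ 2 - C ^ 2) / (2 * A) with hb
  have hbA : 2 * A * b = A ^ 2 + B ^ 2 - C ^ 2 := by rw [hb]; field_simp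
  have hb1 : b ≤ B := by
    by_contra hcon
    push Not at hcon
    nlinarith [mul_lt_mul_of_pos_left hcon h0]
  have hb2 : -B ≤ b := by
    by_contra hcon
    push Not at hcon
    nlinarith [mul_lt_mul_of_pos_left hcon h0]
  have hc : 0 ≤ B ^ 2 - b ^ 2 := by nlinarith
  have hc2 : √(B ^ 2 - b ^ 2) ^ 2 = B ^ 2 - b ^ 2 := Real.sq_sqrt hc
  set c := √(B ^ 2 - b ^ 2) with hcdef
  have key := CAT0Space.dist_le_comparison p q r x r !₂[0, 0] !₂[A, 0] !₂[b, c] !₂[u, 0] !₂[b, c]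
    (by rw [dist_euclidean_pair, Real.sqrt_eq_iff_eq_sq (by positivity) h0.le]; ring)
    (by rw [dist_euclidean_pair, Real.sqrt_eq_iff_eq_sq (by positivity) hB0]; nlinarith)
    (by rw [dist_euclidean_pair, Real.sqrt_eq_iff_eq_sq (by positivity) hC0]; nlinarith)
    h
    (by rw [dist_euclidean_pair, Real.sqrt_eq_iff_eq_sq (by positivity) hu0]; ring)
    (by rw [dist_euclidean_pair, Real.sqrt_eq_iff_eq_sq (by positivity) hv0]
        have : v = A - u := by linarith
        rw [this]; ring)
    (by simp)
    (by rw [dist_euclidean_pair, Real.sqrt_eq_iff_eq_sq (by positivity) hB0]; nlinarith)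
    (by simp)
  rw [dist_euclidean_pair] at key
  have hk : dist x r ^ 2 ≤ (u - b) ^ 2 + (0 - c) ^ 2 := by
    calc dist x r ^ 2 ≤ √((u - b) ^ 2 + (0 - c) ^ 2) ^ 2 := by gcongr
      _ = _ := Real.sq_sqrt (by positivity)
  have hv' : v = A - u := by linarith
  have hcc : c ^ 2 = B ^ 2 - b ^ 2 := hc2
  have e : A * ((u - b) ^ 2 + (0 - c) ^ 2) = v * B ^ 2 + u * C ^ 2 - v * u * A := by
    have : (u - b) ^ 2 + (0 - c) ^ 2 = u ^ 2 - 2 * u * b + B ^ 2 := by linear_combination hcc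
    rw [this, hv']
    linear_combination (-u) * hbA
  calc A * dist x r ^ 2 ≤ A * ((u - b) ^ 2 + (0 - c) ^ 2) := by gcongr
    _ = _ := e

/-- A geodesic defined on a nonempty closed interval. -/
structure IsClosedGeodesic (α : ℝ → X) (I : Set ℝ) : Prop where
  isGeodesicOn : IsGeodesicOn α I
  isClosed : IsClosed I
  nonempty : I.Nonempty

theorem IsGeodesicOn.mono {α : ℝ → X} {I J : Set ℝ} (h : IsGeodesicOn α I)
    (hJ : J.OrdConnected) (hJI : J ⊆ I) : IsGeodesicOn α J :=
  ⟨hJ, fun s hs t ht => h.2 s (hJI hs) t (hJI ht)⟩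

theorem IsGeodesicOn.isClosedGeodesic_Icc {α : ℝ → X} {I : Set ℝ} (h : IsGeodesicOn α I) {s t : ℝ}
    (hs : s ∈ I) (ht : t ∈ I) (hst : s ≤ t) : IsClosedGeodesic α (Icc s t) :=
  ⟨h.mono ordConnected_Icc (h.1.out hs ht), isClosed_Icc, nonempty_Icc.2 hst⟩

theorem IsGeodesicOn.continuousOn {α : ℝ → X} {I : Set ℝ} (h : IsGeodesicOn α I) :
    ContinuousOn α I := by
  have : LipschitzOnWith 1 α I := LipschitzOnWith.of_dist_le_mul fun s hs t ht => by
    rw [h.2 s hs t ht, Real.dist_eq]; simp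
  exact this.continuousOn

theorem IsGeodesicOn.dist_eq {α : ℝ → X} {I : Set ℝ} (h : IsGeodesicOn α I) {s t : ℝ}
    (hs : s ∈ I) (ht : t ∈ I) (hst : s ≤ t) : dist (α s) (α t) = t - s := by
  rw [h.2 s hs t ht, abs_sub_comm, abs_of_nonneg (by linarith)]

theorem IsGeodesicOn.dist_add_dist {α : ℝ → X} {I : Set ℝ} (h : IsGeodesicOn α I) {s t u : ℝ}
    (hs : s ∈ I) (ht : t ∈ I) (hu : u ∈ uIcc s t) :
    dist (α s) (α u) + dist (α u) (α t) = dist (α s) (α t) := by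
  have huI : u ∈ I := h.1.uIcc_subset hs ht hu
  rcases le_total s t with hst | hst
  · rw [uIcc_of_le hst] at hu
    rw [h.dist_eq hs huI hu.1, h.dist_eq huI ht hu.2, h.dist_eq hs ht hst]; ring
  · rw [uIcc_of_ge hst] at hu
    rw [dist_comm, h.dist_eq huI hs hu.2, dist_comm, h.dist_eq ht huI hu.1, dist_comm,
      h.dist_eq ht hs hst]; ring

/-- A continuous function takes every intermediate value along a geodesic. -/
theorem IsGeodesicOn.exists_eq {α : ℝ → X} {I : Set ℝ} (h : IsGeodesicOn α I) {f : X → ℝ}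
    (hf : Continuous f) {s t v : ℝ} (hs : s ∈ I) (ht : t ∈ I) (hsv : f (α s) ≤ v)
    (hvt : v ≤ f (α t)) : ∃ u ∈ uIcc s t, f (α u) = v := by
  have hc : ContinuousOn (fun u => f (α u)) (uIcc s t) :=
    hf.comp_continuousOn (h.continuousOn.mono (h.1.uIcc_subset hs ht))
  have := intermediate_value_uIcc hc (mem_uIcc.2 (Or.inl ⟨hsv, hvt⟩))
  obtain ⟨u, hu, hu'⟩ := this
  exact ⟨u, hu, hu'⟩

theorem IsGeodesicOn.exists_eq_Icc {α : ℝ → X} {I : Set ℝ} (h : IsGeodesicOn α I) {f : X → ℝ}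
    (hf : Continuous f) {s t v : ℝ} (hs : s ∈ I) (ht : t ∈ I) (hst : s ≤ t)
    (hv : (f (α s) ≤ v ∧ v ≤ f (α t)) ∨ (f (α t) ≤ v ∧ v ≤ f (α s))) :
    ∃ u ∈ Icc s t, f (α u) = v := by
  rcases hv with ⟨h1, h2⟩ | ⟨h1, h2⟩
  · simpa [uIcc_of_le hst] using h.exists_eq hf hs ht h1 h2
  · simpa [uIcc_of_ge hst] using h.exists_eq hf ht hs h1 h2

/-- Any two points are joined by a geodesic. -/
theorem CAT0Space.exists_isGeodesicOn [CAT0Space X] (x y : X) : ∃ γ : ℝ → X,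
    IsClosedGeodesic γ (Icc 0 (dist x y)) ∧ γ 0 = x ∧ γ (dist x y) = y := by
  obtain ⟨γ, h, h0, h1⟩ := CAT0Space.exists_geodesic x y
  exact ⟨γ, ⟨h, isClosed_Icc, nonempty_Icc.2 dist_nonneg⟩, h0, h1⟩

variable [CAT0Space X]

theorem IsGeodesicOn.mul_sq_dist_le {α : ℝ → X} {I : Set ℝ} (h : IsGeodesicOn α I) {s t u : ℝ}
    (hs : s ∈ I) (ht : t ∈ I) (hu : u ∈ Icc s t) (x : X) :
    (t - s) * dist x (α u) ^ 2 ≤ (t - u) * dist x (α s) ^ 2 + (u - s) * dist x (α t) ^ 2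
      - (t - u) * (u - s) * (t - s) := by
  have huI : u ∈ I := h.1.out hs ht hu
  have := CAT0Space.mul_sq_dist_le (r := x)
    (h.dist_add_dist hs ht (by rwa [uIcc_of_le (hu.1.trans hu.2)]))
  rwa [h.dist_eq hs ht (hu.1.trans hu.2), h.dist_eq hs huI hu.1, h.dist_eq huI ht hu.2,
    dist_comm _ x, dist_comm _ x, dist_comm _ x] at this

/-- Distance to a point is convex along geodesics. -/
theorem IsGeodesicOn.mul_dist_le {α : ℝ → X} {I : Set ℝ} (h : IsGeodesicOn α I) {s t u : ℝ}
    (hs : s ∈ I) (ht : t ∈ I) (hu : u ∈ Icc s t) (x : X) :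
    (t - s) * dist x (α u) ≤ (t - u) * dist x (α s) + (u - s) * dist x (α t) := by
  have h1 := h.mul_sq_dist_le hs ht hu x
  have h2 := h.dist_eq hs ht (hu.1.trans hu.2)
  have h3 : |dist x (α s) - dist x (α t)| ≤ t - s := by
    rw [← h2, dist_comm x, dist_comm x]; exact abs_dist_sub_le _ _ _
  have a0 := dist_nonneg (x := x) (y := α s)
  have b0 := dist_nonneg (x := x) (y := α t)
  have hts : 0 ≤ t - u := by linarith [hu.2]
  have hus : 0 ≤ u - s := by linarith [hu.1]
  have hst : 0 ≤ t - s := by linarith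
  -- After squaring, what remains of Bruhat–Tits is that the distances to the endpoints differ by at
  -- most `t - s`.
  refine abs_le_of_sq_le_sq' ?_ (by positivity) |>.2
  have h4 : (dist x (α s) - dist x (α t)) ^ 2 ≤ (t - s) ^ 2 := by
    rw [← sq_abs]; gcongr
  nlinarith [mul_le_mul_of_nonneg_left h1 hst, mul_nonneg hts hus,
    mul_le_mul_of_nonneg_left h4 (mul_nonneg hts hus)]

/-- The quadrilateral inequality. -/
theorem CAT0Space.sq_dist_add_sq_dist_le (a b c d : X) :
    dist a c ^ 2 + dist b d ^ 2 ≤ dist a b ^ 2 + dist b c ^ 2 + dist c d ^ 2 + dist d a ^ 2 := by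
  obtain ⟨γ, hγ, h0, h1⟩ := CAT0Space.exists_isGeodesicOn a c
  have hD := dist_nonneg (x := a) (y := c)
  -- Bruhat–Tits at the midpoint of `[a, c]` bounds its distances to `b` and `d`; the triangle
  -- inequality through the midpoint does the rest.
  have hm : dist a c / 2 ∈ Icc 0 (dist a c) := ⟨by linarith, by linarith⟩
  have hb := hγ.isGeodesicOn.mul_sq_dist_le (left_mem_Icc.2 hD) (right_mem_Icc.2 hD) hm b
  have hd := hγ.isGeodesicOn.mul_sq_dist_le (left_mem_Icc.2 hD) (right_mem_Icc.2 hD) hm d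
  rw [h0, h1] at hb hd
  rcases eq_or_lt_of_le hD with h | h
  · have : a = c := dist_eq_zero.1 h.symm
    subst this
    have t := dist_triangle b a d
    rw [dist_comm a b, dist_comm d a, dist_self]
    nlinarith [sq_nonneg (dist b a - dist a d), dist_nonneg (x := b) (y := d),
      dist_nonneg (x := b) (y := a), dist_nonneg (x := a) (y := d)]
  · have hb' : dist b (γ (dist a c / 2)) ^ 2 ≤
        (dist b a ^ 2 + dist b c ^ 2) / 2 - dist a c ^ 2 / 4 := by
      refine le_of_mul_le_mul_left ?_ h
      linarith
    have hd' : dist d (γ (dist a c / 2)) ^ 2 ≤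
        (dist d a ^ 2 + dist d c ^ 2) / 2 - dist a c ^ 2 / 4 := by
      refine le_of_mul_le_mul_left ?_ h
      linarith
    have t := dist_triangle_right b d (γ (dist a c / 2))
    rw [dist_comm a b, dist_comm c d]
    nlinarith [sq_nonneg (dist b (γ (dist a c / 2)) - dist d (γ (dist a c / 2))),
      dist_nonneg (x := b) (y := d), dist_nonneg (x := b) (y := γ (dist a c / 2)),
      dist_nonneg (x := d) (y := γ (dist a c / 2))]

end Geodesics

/-! ### Closest-point projection to a geodesic. -/

section Foot

variable {X : Type*} [MetricSpace X]

open Classical in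
/-- The parameter of a point of the geodesic `α : I → X` closest to `x`. -/
noncomputable def foot (α : ℝ → X) (I : Set ℝ) (x : X) : ℝ :=
  if h : ∃ t ∈ I, ∀ s ∈ I, dist x (α t) ≤ dist x (α s) then h.choose else 0

namespace IsClosedGeodesic

variable {α : ℝ → X} {I : Set ℝ}

theorem exists_closest (h : IsClosedGeodesic α I) (x : X) :
    ∃ t ∈ I, ∀ s ∈ I, dist x (α t) ≤ dist x (α s) := by
  obtain ⟨a, ha⟩ := h.nonempty
  -- Parameters farther than `R` from `a` give points no closer to `x` than `α a`, so compactness of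
  -- a bounded part of `I` suffices and properness of `X` is not needed.
  set R := 2 * dist x (α a) with hR
  have hR0 : 0 ≤ R := by positivity
  have hK : IsCompact (I ∩ Icc (a - R) (a + R)) := isCompact_Icc.inter_left h.isClosed
  obtain ⟨t, ht, hmin⟩ := hK.exists_isMinOn ⟨a, ha, by constructor <;> linarith⟩
    (f := fun s => dist x (α s))
    ((continuous_const.dist continuous_id).comp_continuousOn
      (h.isGeodesicOn.continuousOn.mono inter_subset_left))
  refine ⟨t, ht.1, fun s hs => ?_⟩
  by_cases hsR : s ∈ Icc (a - R) (a + R)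
  · exact hmin ⟨hs, hsR⟩
  · have h1 : dist x (α t) ≤ dist x (α a) := hmin ⟨ha, by constructor <;> linarith⟩
    have h2 : R < |s - a| := by
      by_contra hcon
      push Not at hcon
      rw [abs_le] at hcon
      exact hsR ⟨by linarith, by linarith⟩
    rw [← h.isGeodesicOn.2 s hs a ha] at h2
    linarith [dist_triangle_left (α s) (α a) x]

theorem foot_mem (h : IsClosedGeodesic α I) (x : X) : foot α I x ∈ I := by
  rw [foot, dif_pos (h.exists_closest x)]
  exact (h.exists_closest x).choose_spec.1

theorem dist_foot_le (h : IsClosedGeodesic α I) (x : X) {s : ℝ} (hs : s ∈ I) :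
    dist x (α (foot α I x)) ≤ dist x (α s) := by
  have := (h.exists_closest x).choose_spec.2 s hs
  rwa [foot, dif_pos (h.exists_closest x)]

variable [CAT0Space X]

/-- First variation: compare `α t` with the point a fraction `θ` of the way towards `α s`.
Bruhat–Tits and minimality, divided by `θ`, give the claim up to a factor `1 - θ`, which is removed
by taking `θ` small. -/
theorem sq_dist_add_le_of_closest (h : IsGeodesicOn α I) {x : X} {s t : ℝ} (ht : t ∈ I)
    (hmin : ∀ s ∈ I, dist x (α t) ≤ dist x (α s)) (hs : s ∈ I) :
    dist x (α t) ^ 2 + (s - t) ^ 2 ≤ dist x (α s) ^ 2 := by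
  set f := dist x (α t)
  set g := dist x (α s)
  have key : ∀ θ : ℝ, 0 < θ → θ < 1 → f ^ 2 + (1 - θ) * (s - t) ^ 2 ≤ g ^ 2 := by
    intro θ h0 h1
    rcases lt_trichotomy s t with hst | hst | hst
    · have hu : t - θ * (t - s) ∈ Icc s t := ⟨by nlinarith, by nlinarith⟩
      have h2 := h.mul_sq_dist_le hs ht hu x
      have h3 := hmin _ (h.1.out hs ht hu)
      have h4 : f ^ 2 ≤ dist x (α (t - θ * (t - s))) ^ 2 := by gcongr
      have h5 : (t - s) * f ^ 2 ≤ (t - s) * dist x (α (t - θ * (t - s))) ^ 2 :=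
        mul_le_mul_of_nonneg_left h4 (by linarith)
      refine le_of_mul_le_mul_left ?_ (mul_pos h0 (sub_pos.2 hst))
      change _ ≤ _ * g ^ 2 + _ * f ^ 2 - _ at h2
      linarith
    · subst hst; simp [f, g]
    · have hu : t + θ * (s - t) ∈ Icc t s := ⟨by nlinarith, by nlinarith⟩
      have h2 := h.mul_sq_dist_le ht hs hu x
      have h3 := hmin _ (h.1.out ht hs hu)
      have h4 : f ^ 2 ≤ dist x (α (t + θ * (s - t))) ^ 2 := by gcongr
      have h5 : (s - t) * f ^ 2 ≤ (s - t) * dist x (α (t + θ * (s - t))) ^ 2 :=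
        mul_le_mul_of_nonneg_left h4 (by linarith)
      refine le_of_mul_le_mul_left ?_ (mul_pos h0 (sub_pos.2 hst))
      change _ ≤ _ * f ^ 2 + _ * g ^ 2 - _ at h2
      linarith
  by_contra hcon
  push Not at hcon
  have h0 : 0 ≤ (s - t) ^ 2 := sq_nonneg _
  set e := f ^ 2 + (s - t) ^ 2 - g ^ 2 with he
  have hepos : 0 < e := by linarith
  have h2 := key (e / (2 * (e + (s - t) ^ 2))) (by positivity)
    (by rw [div_lt_one (by positivity)]; linarith)
  have h3 : e / (2 * (e + (s - t) ^ 2)) * (s - t) ^ 2 < e := by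
    rw [div_mul_eq_mul_div, div_lt_iff₀ (by positivity)]
    nlinarith
  linarith

/-- The angle at the closest point is at least a right angle. -/
theorem sq_dist_foot_add_le (h : IsClosedGeodesic α I) (x : X) {s : ℝ} (hs : s ∈ I) :
    dist x (α (foot α I x)) ^ 2 + (s - foot α I x) ^ 2 ≤ dist x (α s) ^ 2 :=
  sq_dist_add_le_of_closest h.isGeodesicOn (h.foot_mem x) (fun _ => h.dist_foot_le x) hs

theorem foot_eq (h : IsClosedGeodesic α I) {x : X} {t : ℝ} (ht : t ∈ I)
    (hmin : ∀ s ∈ I, dist x (α t) ≤ dist x (α s)) : foot α I x = t := by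
  have h1 := sq_dist_add_le_of_closest h.isGeodesicOn ht hmin (h.foot_mem x)
  have h2 : dist x (α (foot α I x)) ^ 2 ≤ dist x (α t) ^ 2 := by
    gcongr; exact h.dist_foot_le x ht
  have h3 : (foot α I x - t) ^ 2 = 0 := le_antisymm (by linarith) (sq_nonneg _)
  linarith [pow_eq_zero_iff (two_ne_zero) |>.1 h3]

theorem foot_apply (h : IsClosedGeodesic α I) {t : ℝ} (ht : t ∈ I) : foot α I (α t) = t :=
  h.foot_eq ht fun s _ => by simp

/-- Adding the two right-angle inequalities at the feet to the quadrilateral inequality for `x`, its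
foot, the foot of `y`, and `y` cancels all other terms. -/
theorem abs_foot_sub_le (h : IsClosedGeodesic α I) (x y : X) :
    |foot α I x - foot α I y| ≤ dist x y := by
  have h1 := h.sq_dist_foot_add_le x (h.foot_mem y)
  have h2 := h.sq_dist_foot_add_le y (h.foot_mem x)
  have h3 := CAT0Space.sq_dist_add_sq_dist_le x (α (foot α I x)) (α (foot α I y)) y
  have h4 := h.isGeodesicOn.2 _ (h.foot_mem x) _ (h.foot_mem y)
  rw [h4, sq_abs, dist_comm (α (foot α I y)) y, dist_comm (α (foot α I x)) y, dist_comm y x] at h3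
  exact abs_le_of_sq_le_sq (by nlinarith) dist_nonneg

theorem continuous_foot (h : IsClosedGeodesic α I) : Continuous (foot α I) := by
  have : LipschitzWith 1 (foot α I) := LipschitzWith.of_dist_le_mul fun x y => by
    rw [Real.dist_eq]; simpa using h.abs_foot_sub_le x y
  exact this.continuous

/-- The projection is constant on the geodesic from `x` to its projection. -/
theorem foot_eq_of_between (h : IsClosedGeodesic α I) {x w : X}
    (hw : dist x w + dist w (α (foot α I x)) = dist x (α (foot α I x))) :
    foot α I w = foot α I x :=
  h.foot_eq (h.foot_mem x) fun s hs => by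
    linarith [h.dist_foot_le x hs, dist_triangle x w (α s)]

/-- A geodesic projects to the endpoint of a geodesic perpendicular to it. -/
theorem foot_perp (h : IsClosedGeodesic α I) {x : X} {β : ℝ → X} {D : ℝ}
    (hβ : IsClosedGeodesic β (Icc 0 D)) (h0 : β 0 = α (foot α I x)) (hD : β D = x) {s : ℝ}
    (hs : s ∈ I) : foot β (Icc 0 D) (α s) = 0 := by
  have hD0 : 0 ≤ D := nonempty_Icc.1 hβ.nonempty
  refine hβ.foot_eq (left_mem_Icc.2 hD0) fun u hu => ?_
  -- All of `β` has the same foot on `α`, so the right-angle inequality is available at every `β u`.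
  have hf : foot α I (β u) = foot α I x := by
    refine h.foot_eq_of_between ?_
    rw [← h0, ← hD]
    exact hβ.isGeodesicOn.dist_add_dist (right_mem_Icc.2 hD0) (left_mem_Icc.2 hD0)
      (by rwa [uIcc_of_ge hD0])
  have := h.sq_dist_foot_add_le (β u) hs
  rw [hf] at this
  rw [h0, dist_comm (α s) (β u), h.isGeodesicOn.2 s hs _ (h.foot_mem x)]
  exact abs_le_of_sq_le_sq (by nlinarith [dist_nonneg (x := β u) (y := α (foot α I x))])
    dist_nonneg

/-- If a geodesic ends at a point `w` between `a` and `b`, then one of the segments `[w, a]`,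
`[w, b]` projects to `w`. -/
theorem foot_eq_of_between_or {β : ℝ → X} {D : ℝ} (hβ : IsClosedGeodesic β (Icc 0 D)) {a b w : X}
    (hD : β D = w) (hw : dist a w + dist w b = dist a b) :
    (∀ z, dist a z + dist z w = dist a w → foot β (Icc 0 D) z = D) ∨
    (∀ z, dist b z + dist z w = dist b w → foot β (Icc 0 D) z = D) := by
  have hD0 : 0 ≤ D := nonempty_Icc.1 hβ.nonempty
  have main : ∀ c : X, (∀ u ∈ Icc 0 D, dist c w ≤ dist c (β u)) →
      ∀ z, dist c z + dist z w = dist c w → foot β (Icc 0 D) z = D := by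
    intro c hc z hz
    refine hβ.foot_eq (right_mem_Icc.2 hD0) fun u hu => ?_
    rw [hD]
    linarith [hc u hu, dist_triangle c z (β u)]
  by_cases ha : ∀ u ∈ Icc 0 D, dist a w ≤ dist a (β u)
  · exact Or.inl (main a ha)
  refine Or.inr (main b ?_)
  by_contra hb
  push Not at ha hb
  -- By convexity, a point of `β` closer to `c` than `w` makes all later points before `w` closer
  -- too. If this happened for both `a` and `b`, one point would beat `w` for both, contradicting
  -- that `w` lies between them.
  have push : ∀ c : X, ∀ u ∈ Icc 0 D, dist c (β u) < dist c w →
      ∀ v, u ≤ v → v < D → dist c (β v) < dist c w := by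
    intro c u hu hc v huv hv
    have := hβ.isGeodesicOn.mul_dist_le hu (right_mem_Icc.2 hD0) ⟨huv, hv.le⟩ c
    rw [hD] at this
    have h1 : (D - v) * dist c (β u) < (D - v) * dist c w :=
      mul_lt_mul_of_pos_left hc (by linarith)
    refine lt_of_mul_lt_mul_left (a := D - u) ?_ (by linarith)
    linarith
  obtain ⟨u, hu, hua⟩ := ha
  obtain ⟨v, hv, hvb⟩ := hb
  have hu' : u < D := lt_of_le_of_ne hu.2 (by rintro rfl; rw [hD] at hua; exact lt_irrefl _ hua)
  have hv' : v < D := lt_of_le_of_ne hv.2 (by rintro rfl; rw [hD] at hvb; exact lt_irrefl _ hvb)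
  have h1 := push a u hu hua (max u v) (le_max_left _ _) (max_lt hu' hv')
  have h2 := push b v hv hvb (max u v) (le_max_right _ _) (max_lt hu' hv')
  rw [dist_comm b, dist_comm b] at h2
  linarith [dist_triangle a (β (max u v)) b]

/-- The preimage of an interval under the projection to a geodesic is connected. -/
theorem isPreconnected_preimage_foot (h : IsClosedGeodesic α I) {J : Set ℝ}
    (hJ : J.OrdConnected) : IsPreconnected (foot α I ⁻¹' J) := by
  have hpole : IsPreconnected (α '' (I ∩ J)) :=
    (h.isGeodesicOn.1.inter hJ).isPreconnected.image _
      (h.isGeodesicOn.continuousOn.mono inter_subset_left)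
  -- Each point is joined to its projection inside its own fibre, and the projections lie in one
  -- connected piece of the geodesic.
  have hray : ∀ x : X, ∃ S : Set X, x ∈ S ∧ α (foot α I x) ∈ S ∧ IsPreconnected S ∧
      ∀ w ∈ S, foot α I w = foot α I x := by
    intro x
    obtain ⟨γ, hγ, h0, h1⟩ := CAT0Space.exists_isGeodesicOn x (α (foot α I x))
    refine ⟨γ '' Icc 0 (dist x (α (foot α I x))), ⟨0, left_mem_Icc.2 dist_nonneg, h0⟩,
      ⟨_, right_mem_Icc.2 dist_nonneg, h1⟩,
      isPreconnected_Icc.image _ hγ.isGeodesicOn.continuousOn, ?_⟩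
    rintro _ ⟨u, hu, rfl⟩
    refine h.foot_eq_of_between ?_
    have := hγ.isGeodesicOn.dist_add_dist (left_mem_Icc.2 dist_nonneg)
      (right_mem_Icc.2 dist_nonneg) (u := u) (by rwa [uIcc_of_le dist_nonneg])
    rwa [h0, h1] at this
  have hsub : α '' (I ∩ J) ⊆ foot α I ⁻¹' J := by
    rintro _ ⟨t, ht, rfl⟩
    rw [mem_preimage, h.foot_apply ht.1]
    exact ht.2
  have hmeet : ∀ x ∈ foot α I ⁻¹' J, α (foot α I x) ∈ α '' (I ∩ J) :=
    fun x hx => ⟨_, ⟨h.foot_mem x, hx⟩, rfl⟩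
  refine isPreconnected_of_forall_pair fun x hx y hy => ?_
  obtain ⟨S, hxS, hS, hSc, hSf⟩ := hray x
  obtain ⟨T, hyT, hT, hTc, hTf⟩ := hray y
  refine ⟨S ∪ α '' (I ∩ J) ∪ T, ?_, Or.inl (Or.inl hxS), Or.inr hyT, ?_⟩
  · refine union_subset (union_subset (fun w hw => ?_) hsub) fun w hw => ?_
    · rw [mem_preimage, hSf w hw]; exact hx
    · rw [mem_preimage, hTf w hw]; exact hy
  · exact (hSc.union _ hS (hmeet x hx) hpole).union _ (Or.inr (hmeet y hy)) hT hTc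

end IsClosedGeodesic

/-- Traversing a geodesic backwards. -/
theorem IsClosedGeodesic.reverse {α : ℝ → X} {I : Set ℝ} (h : IsClosedGeodesic α I) :
    IsClosedGeodesic (fun t => α (-t)) (Neg.neg ⁻¹' I) where
  isGeodesicOn := by
    refine ⟨⟨fun s hs t ht u hu => ?_⟩, fun s hs t ht => ?_⟩
    · exact h.isGeodesicOn.1.out ht hs ⟨neg_le_neg hu.2, neg_le_neg hu.1⟩
    · rw [h.isGeodesicOn.2 _ hs _ ht, abs_sub_comm]; ring_nf
  isClosed := h.isClosed.preimage continuous_neg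
  nonempty := by
    obtain ⟨a, ha⟩ := h.nonempty
    exact ⟨-a, by simpa using ha⟩

theorem IsClosedGeodesic.foot_reverse [CAT0Space X] {α : ℝ → X} {I : Set ℝ}
    (h : IsClosedGeodesic α I) (x : X) :
    foot (fun t => α (-t)) (Neg.neg ⁻¹' I) x = -foot α I x :=
  h.reverse.foot_eq (by simpa using h.foot_mem x) fun s hs => by
    simpa using h.dist_foot_le x hs

end Foot

/-! ### Halfspaces, and the partial order on oriented curtains. -/

section CurtainOrder

variable {X : Type*} [MetricSpace X]

namespace Curtain

theorem mem_I_of_mem_pole (h : Curtain X) {t : ℝ} (ht : t ∈ Icc (h.r - 1 / 2) (h.r + 1 / 2)) :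
    t ∈ h.I :=
  interior_subset (h.pole_subset ht)

theorem isClosedGeodesic (h : Curtain X) : IsClosedGeodesic h.α h.I :=
  ⟨h.isGeodesicOn, h.isClosed_I, ⟨h.r, h.mem_I_of_mem_pole ⟨by linarith, by linarith⟩⟩⟩

/-- The parameter of the projection to the geodesic to which the curtain is dual. -/
noncomputable def coord (h : Curtain X) (x : X) : ℝ := foot h.α h.I x

/-- The complement of the positive halfspace. -/
def lower (h : Curtain X) : Set X := {x | h.coord x ≤ h.r + 1 / 2}

/-- The complement of the negative halfspace. -/
def upper (h : Curtain X) : Set X := {x | h.r - 1 / 2 ≤ h.coord x}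

/-- The curtain with its two halfspaces exchanged. -/
def reverse (h : Curtain X) : Curtain X where
  I := Neg.neg ⁻¹' h.I
  α := fun t => h.α (-t)
  r := -h.r
  isClosed_I := h.isClosed_I.preimage continuous_neg
  isGeodesicOn := h.isClosedGeodesic.reverse.isGeodesicOn
  pole_subset := fun t ht => by
    have : -t ∈ interior h.I := h.pole_subset ⟨by linarith [ht.2], by linarith [ht.1]⟩
    exact preimage_interior_subset_interior_preimage continuous_neg this

/-- One curtain lies on the negative side of another, compatibly with the orientations. -/
def Below (h k : Curtain X) : Prop := h.lower ⊆ k.negHalf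

theorem mem_lower {h : Curtain X} {x : X} : x ∈ h.lower ↔ h.coord x ≤ h.r + 1 / 2 := Iff.rfl

theorem mem_upper {h : Curtain X} {x : X} : x ∈ h.upper ↔ h.r - 1 / 2 ≤ h.coord x := Iff.rfl

variable [CAT0Space X]

theorem mem_projPreimage {h : Curtain X} {J : Set ℝ} {x : X} :
    x ∈ h.projPreimage J ↔ h.coord x ∈ J := by
  constructor
  · rintro ⟨t, ht, hmin⟩
    rw [coord, h.isClosedGeodesic.foot_eq ht.1 hmin]
    exact ht.2
  · intro hx
    exact ⟨h.coord x, ⟨h.isClosedGeodesic.foot_mem x, hx⟩,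
      fun s hs => h.isClosedGeodesic.dist_foot_le x hs⟩

theorem mem_carrier {h : Curtain X} {x : X} :
    x ∈ h.carrier ↔ h.r - 1 / 2 ≤ h.coord x ∧ h.coord x ≤ h.r + 1 / 2 := mem_projPreimage

theorem mem_negHalf {h : Curtain X} {x : X} : x ∈ h.negHalf ↔ h.coord x < h.r - 1 / 2 :=
  mem_projPreimage

theorem mem_posHalf {h : Curtain X} {x : X} : x ∈ h.posHalf ↔ h.r + 1 / 2 < h.coord x :=
  mem_projPreimage

theorem continuous_coord (h : Curtain X) : Continuous h.coord := h.isClosedGeodesic.continuous_foot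

theorem abs_coord_sub_le (h : Curtain X) (x y : X) : |h.coord x - h.coord y| ≤ dist x y :=
  h.isClosedGeodesic.abs_foot_sub_le x y

theorem negHalf_subset_lower (h : Curtain X) : h.negHalf ⊆ h.lower := fun x hx => by
  rw [mem_negHalf] at hx; rw [mem_lower]; linarith

theorem posHalf_subset_upper (h : Curtain X) : h.posHalf ⊆ h.upper := fun x hx => by
  rw [mem_posHalf] at hx; rw [mem_upper]; linarith

theorem carrier_subset_lower (h : Curtain X) : h.carrier ⊆ h.lower :=
  fun _ hx => (mem_carrier.1 hx).2

theorem carrier_subset_upper (h : Curtain X) : h.carrier ⊆ h.upper :=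
  fun _ hx => (mem_carrier.1 hx).1

theorem mem_carrier_of_lower_upper {h : Curtain X} {x : X} (h1 : x ∈ h.lower) (h2 : x ∈ h.upper) :
    x ∈ h.carrier := mem_carrier.2 ⟨h2, h1⟩

theorem notMem_posHalf {h : Curtain X} {x : X} : x ∉ h.posHalf ↔ x ∈ h.lower := by
  rw [mem_posHalf, mem_lower, not_lt]

theorem notMem_negHalf {h : Curtain X} {x : X} : x ∉ h.negHalf ↔ x ∈ h.upper := by
  rw [mem_negHalf, mem_upper, not_lt]

theorem disjoint_negHalf_posHalf {h : Curtain X} {x : X} (h1 : x ∈ h.negHalf)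
    (h2 : x ∈ h.posHalf) : False :=
  notMem_posHalf.2 (h.negHalf_subset_lower h1) h2

theorem carrier_nonempty (h : Curtain X) : h.carrier.Nonempty := by
  refine ⟨h.α h.r, mem_carrier.2 ?_⟩
  rw [coord, h.isClosedGeodesic.foot_apply (h.mem_I_of_mem_pole ⟨by linarith, by linarith⟩)]
  constructor <;> linarith

theorem isPreconnected_coord_preimage (h : Curtain X) {J : Set ℝ} (hJ : J.OrdConnected) :
    IsPreconnected (h.coord ⁻¹' J) :=
  h.isClosedGeodesic.isPreconnected_preimage_foot hJ

theorem isPreconnected_carrier (h : Curtain X) : IsPreconnected h.carrier := by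
  have : h.carrier = h.coord ⁻¹' Icc (h.r - 1 / 2) (h.r + 1 / 2) := by
    ext x; exact mem_projPreimage
  rw [this]; exact h.isPreconnected_coord_preimage ordConnected_Icc

theorem isPreconnected_lower (h : Curtain X) : IsPreconnected h.lower :=
  h.isPreconnected_coord_preimage (J := Iic _) ordConnected_Iic

theorem isPreconnected_upper (h : Curtain X) : IsPreconnected h.upper :=
  h.isPreconnected_coord_preimage (J := Ici _) ordConnected_Ici

/-- A connected set with points on either side of a curtain meets the curtain. -/
theorem exists_mem_carrier {h : Curtain X} {S : Set X} (hS : IsPreconnected S) {x y : X}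
    (hx : x ∈ S) (hy : y ∈ S) (hxl : x ∈ h.lower) (hyu : y ∈ h.upper) : (S ∩ h.carrier).Nonempty := by
  by_cases h1 : x ∈ h.upper
  · exact ⟨x, hx, mem_carrier_of_lower_upper hxl h1⟩
  by_cases h2 : y ∈ h.lower
  · exact ⟨y, hy, mem_carrier_of_lower_upper h2 hyu⟩
  rw [mem_lower, not_le] at h2
  rw [mem_upper, not_le] at h1
  obtain ⟨z, hz, hz'⟩ := hS.intermediate_value hx hy h.continuous_coord.continuousOn
    (show h.r ∈ Icc (h.coord x) (h.coord y) from ⟨by linarith, by linarith⟩)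
  exact ⟨z, hz, mem_carrier.2 ⟨by linarith, by linarith⟩⟩

theorem subset_negHalf {h : Curtain X} {S : Set X} (hS : IsPreconnected S)
    (hd : Disjoint S h.carrier) {x : X} (hx : x ∈ S) (hxl : x ∈ h.lower) : S ⊆ h.negHalf := by
  intro y hy
  by_contra hcon
  obtain ⟨z, hz, hz'⟩ := exists_mem_carrier hS hx hy hxl (notMem_negHalf.1 hcon)
  exact disjoint_left.1 hd hz hz'

theorem subset_posHalf {h : Curtain X} {S : Set X} (hS : IsPreconnected S)
    (hd : Disjoint S h.carrier) {x : X} (hx : x ∈ S) (hxu : x ∈ h.upper) : S ⊆ h.posHalf := by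
  intro y hy
  by_contra hcon
  obtain ⟨z, hz, hz'⟩ := exists_mem_carrier hS hy hx (notMem_posHalf.1 hcon) hxu
  exact disjoint_left.1 hd hz hz'

namespace Below

variable {h k l m : Curtain X}

theorem trans (hk : h.Below k) (kl : k.Below l) : h.Below l :=
  fun _ hx => kl (k.negHalf_subset_lower (hk hx))

theorem upper_subset (hk : h.Below k) : k.upper ⊆ h.posHalf := fun x hx => by
  by_contra hcon
  exact notMem_negHalf.2 hx (hk (notMem_posHalf.1 hcon))

theorem lower_subset (hk : h.Below k) : h.lower ⊆ k.lower :=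
  fun _ hx => k.negHalf_subset_lower (hk hx)

theorem disjoint (hk : h.Below k) : Disjoint h.carrier k.carrier :=
  disjoint_left.2 fun _ hx hy =>
    notMem_negHalf.2 (k.carrier_subset_upper hy) (hk (h.carrier_subset_lower hx))

/-- A curtain that meets two curtains meets all curtains in between. -/
theorem meets_of_between (hk : h.Below k) (kl : k.Below l) {m : Curtain X} (h1 : m.Meets h)
    (h2 : m.Meets l) : m.Meets k := by
  obtain ⟨x, hx, hxh⟩ := h1
  obtain ⟨y, hy, hyl⟩ := h2
  exact exists_mem_carrier m.isPreconnected_carrier hx hy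
    (k.negHalf_subset_lower (hk (h.carrier_subset_lower hxh)))
    (k.posHalf_subset_upper (kl.upper_subset (l.carrier_subset_upper hyl)))

/-- A chain meeting the outer two curtains also meets the one in between, so separation is inherited
by wider pairs. -/
theorem lSeparated_right {L : ℕ} (hk : h.Below k) (kl : k.Below l) (hs : LSeparated L h k) :
    LSeparated L h l :=
  ⟨(hk.trans kl).disjoint, fun n c hc hm => hs.2 n c hc fun i =>
    ⟨(hm i).1, hk.meets_of_between kl (hm i).1 (hm i).2⟩⟩

theorem lSeparated_left {L : ℕ} (hk : h.Below k) (kl : k.Below l) (hs : LSeparated L k l) :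
    LSeparated L h l :=
  ⟨(hk.trans kl).disjoint, fun n c hc hm => hs.2 n c hc fun i =>
    ⟨hk.meets_of_between kl (hm i).1 (hm i).2, (hm i).2⟩⟩

end Below

/-- Disjoint curtains, both of which have `x` on the negative side and `y` on the positive side,
are nested. -/
theorem below_or_below {h k : Curtain X} (hd : Disjoint h.carrier k.carrier) {x y : X}
    (hx : x ∈ h.negHalf) (hy : y ∈ h.posHalf) (hx' : x ∈ k.negHalf) (hy' : y ∈ k.posHalf) :
    h.Below k ∨ k.Below h := by
  obtain ⟨p, hp⟩ := h.carrier_nonempty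
  -- Being connected and disjoint from `k`, the curtain `h` lies on a single side of `k`, and one of
  -- its points tells which. A closed side of `k` is then connected, misses `h`, and contains `x` or
  -- `y`, which places it relative to `h`.
  by_cases hpk : p ∈ k.lower
  · left
    have h1 := subset_negHalf h.isPreconnected_carrier hd hp hpk
    have h2 : Disjoint k.upper h.carrier := disjoint_left.2 fun z hz hz' =>
      notMem_negHalf.2 hz (h1 hz')
    have h3 := subset_posHalf k.isPreconnected_upper h2 (k.posHalf_subset_upper hy')
      (h.posHalf_subset_upper hy)
    intro z hz
    by_contra hcon
    exact notMem_posHalf.2 hz (h3 (notMem_negHalf.1 hcon))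
  · right
    have h1 := subset_posHalf h.isPreconnected_carrier hd hp
      (k.posHalf_subset_upper (not_not.1 (mt notMem_posHalf.1 hpk)))
    have h2 : Disjoint k.lower h.carrier := disjoint_left.2 fun z hz hz' =>
      notMem_posHalf.2 hz (h1 hz')
    exact subset_negHalf k.isPreconnected_lower h2 (k.negHalf_subset_lower hx')
      (h.negHalf_subset_lower hx)

theorem coord_reverse (h : Curtain X) (x : X) : h.reverse.coord x = -h.coord x :=
  h.isClosedGeodesic.foot_reverse x

theorem negHalf_reverse (h : Curtain X) : h.reverse.negHalf = h.posHalf := by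
  ext x
  rw [mem_negHalf, mem_posHalf, coord_reverse]
  change _ < -h.r - 1 / 2 ↔ _
  constructor <;> intro <;> linarith

theorem posHalf_reverse (h : Curtain X) : h.reverse.posHalf = h.negHalf := by
  ext x
  rw [mem_negHalf, mem_posHalf, coord_reverse]
  change -h.r + 1 / 2 < _ ↔ _
  constructor <;> intro <;> linarith

theorem lower_reverse (h : Curtain X) : h.reverse.lower = h.upper := by
  ext x
  rw [← notMem_posHalf, ← notMem_negHalf, posHalf_reverse]

theorem upper_reverse (h : Curtain X) : h.reverse.upper = h.lower := by
  ext x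
  rw [← notMem_posHalf, ← notMem_negHalf, negHalf_reverse]

theorem carrier_reverse (h : Curtain X) : h.reverse.carrier = h.carrier := by
  ext x
  constructor
  · intro hx
    refine mem_carrier_of_lower_upper ?_ ?_
    · rw [← upper_reverse]; exact carrier_subset_upper _ hx
    · rw [← lower_reverse]; exact carrier_subset_lower _ hx
  · intro hx
    refine mem_carrier_of_lower_upper ?_ ?_
    · rw [lower_reverse]; exact carrier_subset_upper _ hx
    · rw [upper_reverse]; exact carrier_subset_lower _ hx

theorem Below.reverse {h k : Curtain X} (hk : h.Below k) : k.reverse.Below h.reverse := by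
  rw [Below, lower_reverse, negHalf_reverse]
  exact hk.upper_subset

end Curtain

theorem LSeparated.symm {L : ℕ} {h k : Curtain X} (hk : LSeparated L h k) : LSeparated L k h :=
  ⟨hk.1.symm, fun n c hc hm => hk.2 n c hc fun i => (hm i).symm⟩

theorem LSeparated.congr {L : ℕ} {h k h' k' : Curtain X} (hh : h.carrier = h'.carrier)
    (hk : k.carrier = k'.carrier) (hs : LSeparated L h k) : LSeparated L h' k' := by
  simpa only [LSeparated, Curtain.Meets, hh, hk] using hs

theorem LSeparated.reverse [CAT0Space X] {L : ℕ} {h k : Curtain X} (hs : LSeparated L h k) :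
    LSeparated L k.reverse h.reverse :=
  hs.symm.congr k.carrier_reverse.symm h.carrier_reverse.symm

end CurtainOrder

/-! ### Towers, the oriented form of `L`-chains. -/

section Towers

variable {X : Type*} [MetricSpace X]

/-- The first `n` curtains of the sequence `c` are nested and pairwise `L`-separated. -/
structure IsLTower (L : ℕ) (c : ℕ → Curtain X) (n : ℕ) : Prop where
  below : ∀ i j, i < j → j < n → (c i).Below (c j)
  sep : ∀ i j, i < j → j < n → LSeparated L (c i) (c j)

/-- There is a nested sequence of `n` pairwise `L`-separated curtains, all with `x` on the negative
side and `y` on the positive side. -/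
def HasLTower (L n : ℕ) (x y : X) : Prop :=
  -- The case `n = 0` is set apart because `X` may have no curtains with which to fill an infinite
  -- sequence.
  n = 0 ∨ ∃ c, IsLTower L c n ∧ ∀ i < n, x ∈ (c i).negHalf ∧ y ∈ (c i).posHalf

theorem IsLTower.shift {L n m : ℕ} {c : ℕ → Curtain X} (hc : IsLTower L c n) (k : ℕ)
    (hm : k + m ≤ n) : IsLTower L (fun i => c (k + i)) m :=
  ⟨fun i j hij hj => hc.below _ _ (by omega) (by omega),
    fun i j hij hj => hc.sep _ _ (by omega) (by omega)⟩

variable [CAT0Space X]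

theorem IsLTower.reverse {L n : ℕ} {c : ℕ → Curtain X} (hc : IsLTower L c n) :
    IsLTower L (fun i => (c (n - 1 - i)).reverse) n :=
  ⟨fun i j hij hj => (hc.below (n - 1 - j) (n - 1 - i) (by omega) (by omega)).reverse,
    fun i j hij hj => (hc.sep (n - 1 - j) (n - 1 - i) (by omega) (by omega)).reverse⟩

theorem isLTower_of_succ {L n : ℕ} {c : ℕ → Curtain X}
    (hb : ∀ i, i + 1 < n → (c i).Below (c (i + 1)))
    (hs : ∀ i < n, ∀ j < n, i ≠ j → LSeparated L (c i) (c j)) : IsLTower L c n := by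
  refine ⟨fun i j hij => ?_, fun i j hij hj => hs i (by omega) j hj (by omega)⟩
  induction j, hij using Nat.le_induction with
  | base => exact hb i
  | succ j hj ih => exact fun hjn => (ih (by omega)).trans (hb j hjn)

/-- Points on different sides of a stretch of a tower are far from each other. -/
theorem IsLTower.sub_le_dist {L n : ℕ} {c : ℕ → Curtain X} (hc : IsLTower L c n) {i j : ℕ}
    (hij : i < j) (hj : j < n) {a b : X} (ha : a ∈ (c i).lower) (hb : b ∈ (c j).upper) :
    (j : ℝ) - i - 1 ≤ dist a b := by
  induction j, hij using Nat.le_induction generalizing b with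
  | base => push_cast; linarith [dist_nonneg (x := a) (y := b)]
  | succ j hij ih =>
    obtain ⟨γ, hγ, h0, h1⟩ := CAT0Space.exists_isGeodesicOn a b
    have hD := dist_nonneg (x := a) (y := b)
    have hbj : b ∈ (c j).posHalf := (hc.below j (j + 1) (by omega) hj).upper_subset hb
    have haj : a ∈ (c j).negHalf := hc.below i j (by omega) (by omega) ha
    rw [Curtain.mem_posHalf] at hbj
    rw [Curtain.mem_negHalf] at haj
    -- Cut the geodesic where it enters `c j`: induction bounds the part before, and the part after
    -- has to cross the pole, of length 1.
    obtain ⟨u, hu, huv⟩ := hγ.isGeodesicOn.exists_eq_Icc (c j).continuous_coord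
      (left_mem_Icc.2 hD) (right_mem_Icc.2 hD) hD (v := (c j).r - 1 / 2)
      (Or.inl ⟨by rw [h0]; linarith, by rw [h1]; linarith⟩)
    have h2 := hγ.isGeodesicOn.dist_add_dist (left_mem_Icc.2 hD) (right_mem_Icc.2 hD) (u := u)
      (by rwa [uIcc_of_le hD])
    rw [h0, h1] at h2
    have h3 := ih (b := γ u) (by omega) (by rw [Curtain.mem_upper, huv])
    have h4 := (c j).abs_coord_sub_le (γ u) b
    rw [huv, abs_sub_comm] at h4
    have h5 := le_abs_self ((c j).coord b - ((c j).r - 1 / 2))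
    push_cast
    linarith

theorem Curtain.separates_congr {h h' k k' l l' : Curtain X} (hh : h' = h ∨ h' = h.reverse)
    (hk : k'.carrier = k.carrier) (hl : l'.carrier = l.carrier)
    (hs : h.Separates k.carrier l.carrier) : h'.Separates k'.carrier l'.carrier := by
  rw [hk, hl]
  rcases hh with rfl | rfl
  · exact hs
  · rw [Curtain.Separates, Curtain.negHalf_reverse, Curtain.posHalf_reverse]
    exact hs.symm

/-- Once every curtain is oriented with `x` on its negative side, neighbours in the chain are
nested. A change of direction in the nesting would put both neighbours of some curtain on the same
side of it, contrary to the chain condition. So the order is monotone, and is reversed if it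
decreases. -/
theorem mem_separatingLengths {L n : ℕ} {x y : X} :
    n ∈ separatingLengths L x y ↔ HasLTower L n x y := by
  classical
  constructor
  · rintro ⟨c, ⟨⟨-, hchain⟩, hsep⟩, hxy⟩
    rcases Nat.eq_zero_or_pos n with hn | hn
    · exact Or.inl hn
    right
    let o : Fin n → Curtain X := fun i => if x ∈ (c i).negHalf then c i else (c i).reverse
    have ho : ∀ i, o i = c i ∨ o i = (c i).reverse := fun i => by
      by_cases h : x ∈ (c i).negHalf <;> simp [o, h]
    have hoc : ∀ i, (o i).carrier = (c i).carrier := fun i => by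
      rcases ho i with h | h <;> rw [h]
      exact Curtain.carrier_reverse _
    have hoxy : ∀ i, x ∈ (o i).negHalf ∧ y ∈ (o i).posHalf := fun i => by
      rcases hxy i with ⟨hx, hy⟩ | ⟨hx, hy⟩
      · have : o i = c i := if_pos (singleton_subset_iff.1 hx)
        rw [this]; exact ⟨singleton_subset_iff.1 hx, singleton_subset_iff.1 hy⟩
      · have : o i = (c i).reverse := if_neg fun h =>
          Curtain.disjoint_negHalf_posHalf h (singleton_subset_iff.1 hx)
        rw [this, Curtain.negHalf_reverse, Curtain.posHalf_reverse]
        exact ⟨singleton_subset_iff.1 hx, singleton_subset_iff.1 hy⟩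
    -- Beyond the end of the chain the last curtain is repeated, hence the separate case `n = 1`
    -- when `d 0` and `d 1` are compared.
    let d : ℕ → Curtain X := fun i => o ⟨min i (n - 1), by omega⟩
    have hd : ∀ i (hi : i < n), d i = o ⟨i, hi⟩ := fun i hi => by
      simp only [d]; congr; omega
    have hds : ∀ i < n, ∀ j < n, i ≠ j → LSeparated L (d i) (d j) := fun i hi j hj hij => by
      rw [hd i hi, hd j hj]
      exact (hsep ⟨i, hi⟩ ⟨j, hj⟩ (by simpa using hij)).congr (hoc _).symm (hoc _).symm
    have hdx : ∀ i, x ∈ (d i).negHalf ∧ y ∈ (d i).posHalf := fun i => hoxy _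
    have hcomp : ∀ i, i + 1 < n → (d i).Below (d (i + 1)) ∨ (d (i + 1)).Below (d i) := fun i hi =>
      Curtain.below_or_below (hds i (by omega) (i + 1) hi (by omega)).1 (hdx _).1 (hdx _).2
        (hdx _).1 (hdx _).2
    have hcons : ∀ i, i + 2 < n → (d (i + 1)).Separates (d i).carrier (d (i + 2)).carrier :=
      fun i hi => by
        rw [hd i (by omega), hd (i + 1) (by omega), hd (i + 2) hi]
        exact Curtain.separates_congr (ho _) (hoc _) (hoc _) (hchain _ _ _ rfl rfl)
    have hno : ∀ (h k l : Curtain X), h.Separates k.carrier l.carrier →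
        (k.Below h ∧ l.Below h) ∨ (h.Below k ∧ h.Below l) → False := by
      rintro h k l hs hb
      obtain ⟨p, hp⟩ := k.carrier_nonempty
      obtain ⟨q, hq⟩ := l.carrier_nonempty
      rcases hb with ⟨h1, h2⟩ | ⟨h1, h2⟩
      · have p1 := h1 (k.carrier_subset_lower hp)
        have q1 := h2 (l.carrier_subset_lower hq)
        rcases hs with hs | hs
        · exact Curtain.disjoint_negHalf_posHalf q1 (hs.2 hq)
        · exact Curtain.disjoint_negHalf_posHalf p1 (hs.1 hp)
      · have p1 := h1.upper_subset (k.carrier_subset_upper hp)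
        have q1 := h2.upper_subset (l.carrier_subset_upper hq)
        rcases hs with hs | hs
        · exact Curtain.disjoint_negHalf_posHalf (hs.1 hp) p1
        · exact Curtain.disjoint_negHalf_posHalf (hs.2 hq) q1
    by_cases h0 : n = 1 ∨ (d 0).Below (d 1)
    · refine ⟨d, isLTower_of_succ (fun i => ?_) hds, fun i _ => hdx i⟩
      induction i with
      | zero => exact fun h => h0.resolve_left (by omega)
      | succ i ih =>
        intro hi
        refine (hcomp (i + 1) hi).resolve_right fun hcon => ?_
        exact hno _ _ _ (hcons i hi) (Or.inl ⟨ih (by omega), hcon⟩)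
    · push Not at h0
      have hb : ∀ i, i + 1 < n → (d (i + 1)).Below (d i) := by
        intro i
        induction i with
        | zero => exact fun h => (hcomp 0 h).resolve_left h0.2
        | succ i ih =>
          intro hi
          refine (hcomp (i + 1) hi).resolve_left fun hcon => ?_
          exact hno _ _ _ (hcons i hi) (Or.inr ⟨ih (by omega), hcon⟩)
      refine ⟨fun i => d (n - 1 - i), isLTower_of_succ (fun i hi => ?_)
        (fun i hi j hj hij => hds _ (by omega) _ (by omega) (by omega)), fun i _ => hdx _⟩
      have := hb (n - 1 - (i + 1)) (by omega)
      rwa [show n - 1 - (i + 1) + 1 = n - 1 - i by omega] at this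
  · rintro (rfl | ⟨c, hc, hxy⟩)
    · exact ⟨fun i => i.elim0, ⟨⟨fun i => i.elim0, fun i => i.elim0⟩, fun i => i.elim0⟩,
        fun i => i.elim0⟩
    · have hs : ∀ i j : Fin n, i ≠ j → LSeparated L (c i) (c j) := fun i j hij => by
        rcases lt_or_gt_of_ne hij with h | h
        · exact hc.sep _ _ h j.2
        · exact (hc.sep _ _ h i.2).symm
      refine ⟨fun i => c i, ⟨⟨fun i j hij => (hs i j hij).1, fun i j k hij hjk => Or.inl ⟨?_, ?_⟩⟩,
        hs⟩, fun i => Or.inl ?_⟩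
      · exact (c i).carrier_subset_lower.trans (hc.below _ _ (by omega) j.2)
      · exact (c k).carrier_subset_upper.trans (hc.below _ _ (by omega) k.2).upper_subset
      · simpa using hxy i i.2

theorem HasLTower.le_dist {L n : ℕ} {x y : X} (h : HasLTower L n x y) : (n : ℝ) ≤ dist x y + 2 := by
  rcases h with rfl | ⟨c, hc, hxy⟩
  · have := dist_nonneg (x := x) (y := y); push_cast; linarith
  · rcases Nat.lt_or_ge n 2 with hn | hn
    · have h1 : (n : ℝ) ≤ 1 := by exact_mod_cast (by omega : n ≤ 1)
      linarith [dist_nonneg (x := x) (y := y)]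
    · have := hc.sub_le_dist (i := 0) (j := n - 1) (by omega) (by omega)
        ((c 0).negHalf_subset_lower (hxy 0 (by omega)).1)
        ((c (n - 1)).posHalf_subset_upper (hxy (n - 1) (by omega)).2)
      rw [Nat.cast_sub (by omega)] at this
      push_cast at this
      linarith

end Towers

/-! ### Isometries act on curtains and preserve the curtain metric. -/

section Isometries

variable {X : Type*} [MetricSpace X]

/-- The image of a curtain under an isometry. -/
def Curtain.map (h : Curtain X) (g : X ≃ᵢ X) : Curtain X where
  I := h.I
  α := fun t => g (h.α t)
  r := h.r
  isClosed_I := h.isClosed_I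
  isGeodesicOn := ⟨h.isGeodesicOn.1, fun s hs t ht => by
    rw [g.dist_eq, h.isGeodesicOn.2 s hs t ht]⟩
  pole_subset := h.pole_subset

theorem Curtain.projPreimage_map (h : Curtain X) (g : X ≃ᵢ X) (J : Set ℝ) :
    (h.map g).projPreimage J = g.symm ⁻¹' h.projPreimage J := by
  ext x
  obtain ⟨y, rfl⟩ := g.surjective x
  simp [Curtain.projPreimage, Curtain.map, g.dist_eq]

theorem Curtain.carrier_map (h : Curtain X) (g : X ≃ᵢ X) :
    (h.map g).carrier = g.symm ⁻¹' h.carrier := h.projPreimage_map g _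

theorem Curtain.Separates.map {h : Curtain X} {A B : Set X} (hs : h.Separates A B) (g : X ≃ᵢ X) :
    (h.map g).Separates (g.symm ⁻¹' A) (g.symm ⁻¹' B) := by
  rcases hs with hs | hs
  · exact Or.inl ⟨(preimage_mono hs.1).trans (h.projPreimage_map g _).ge,
      (preimage_mono hs.2).trans (h.projPreimage_map g _).ge⟩
  · exact Or.inr ⟨(preimage_mono hs.1).trans (h.projPreimage_map g _).ge,
      (preimage_mono hs.2).trans (h.projPreimage_map g _).ge⟩

theorem IsCurtainChain.map {n : ℕ} {c : Fin n → Curtain X} (hc : IsCurtainChain c) (g : X ≃ᵢ X) :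
    IsCurtainChain fun i => (c i).map g := by
  refine ⟨fun i j hij => ?_, fun i j k hij hjk => ?_⟩
  · rw [Curtain.carrier_map, Curtain.carrier_map]
    exact (hc.1 i j hij).preimage _
  · rw [Curtain.carrier_map, Curtain.carrier_map]
    exact (hc.2 i j k hij hjk).map g

theorem LSeparated.map {L : ℕ} {h k : Curtain X} (hs : LSeparated L h k) (g : X ≃ᵢ X) :
    LSeparated L (h.map g) (k.map g) := by
  have key : ∀ c l : Curtain X, c.Meets (l.map g) → (c.map g.symm).Meets l := by
    rintro c l ⟨x, hx, hx'⟩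
    rw [Curtain.carrier_map] at hx'
    refine ⟨g.symm x, ?_, hx'⟩
    rw [Curtain.carrier_map]
    simpa using hx
  refine ⟨?_, fun n c hc hm => hs.2 n _ (hc.map g.symm) fun i =>
    ⟨key _ _ (hm i).1, key _ _ (hm i).2⟩⟩
  rw [Curtain.carrier_map, Curtain.carrier_map]
  exact hs.1.preimage _

theorem separatingLengths_subset_map (L : ℕ) (g : X ≃ᵢ X) (x y : X) :
    separatingLengths L x y ⊆ separatingLengths L (g x) (g y) := by
  rintro n ⟨c, ⟨hc, hs⟩, hxy⟩
  refine ⟨fun i => (c i).map g, ⟨hc.map g, fun i j hij => (hs i j hij).map g⟩, fun i => ?_⟩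
  have h : ∀ z : X, {g z} = g.symm ⁻¹' {z} := fun z => by
    ext w; simp [g.symm_apply_eq]
  rw [h, h]
  exact (hxy i).map g

theorem curtainDist_self (L : ℕ) (x : X) : curtainDist L x x = 0 := if_pos rfl

theorem curtainDist_map (L : ℕ) (g : X ≃ᵢ X) (x y : X) :
    curtainDist L (g x) (g y) = curtainDist L x y := by
  have : separatingLengths L (g x) (g y) = separatingLengths L x y :=
    Subset.antisymm (by simpa using separatingLengths_subset_map L g.symm (g x) (g y))
      (separatingLengths_subset_map L g x y)
  by_cases hxy : x = y
  · rw [hxy, curtainDist_self, curtainDist_self]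
  · rw [curtainDist, curtainDist, if_neg hxy, if_neg (g.injective.ne hxy), this]

theorem isometryGroup_le_isometryGroup_curtainDist (L : ℕ) :
    isometryGroup (fun x y : X => dist x y) ≤ isometryGroup (curtainDist (X := X) L) :=
  fun g hg x y => curtainDist_map L ⟨g, Isometry.of_dist_eq hg⟩ x y

end Isometries

/-! ### The curtain metric and its monotonicity in `L`. -/

section CurtainMetric

variable {X : Type*} [MetricSpace X]

theorem curtainDist_nonneg (L : ℕ) (x y : X) : 0 ≤ curtainDist L x y := by
  unfold curtainDist
  split_ifs <;> positivity

theorem one_le_curtainDist (L : ℕ) {x y : X} (hxy : x ≠ y) : 1 ≤ curtainDist L x y := by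
  rw [curtainDist, if_neg hxy]
  exact le_add_of_nonneg_right (Nat.cast_nonneg _)

variable [CAT0Space X]

theorem bddAbove_separatingLengths (L : ℕ) (x y : X) : BddAbove (separatingLengths L x y) := by
  refine ⟨⌈dist x y + 2⌉₊, fun n hn => ?_⟩
  exact_mod_cast (mem_separatingLengths.1 hn).le_dist.trans (Nat.le_ceil _)

theorem HasLTower.add_one_le {L n : ℕ} {x y : X} (h : HasLTower L n x y) (hxy : x ≠ y) :
    (n : ℝ) + 1 ≤ curtainDist L x y := by
  rw [curtainDist, if_neg hxy, add_comm]
  gcongr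
  exact le_csSup (bddAbove_separatingLengths L x y) (mem_separatingLengths.2 h)

theorem HasLTower.le_curtainDist {L n : ℕ} {x y : X} (h : HasLTower L n x y) :
    (n : ℝ) ≤ curtainDist L x y := by
  by_cases hxy : x = y
  · subst hxy
    rcases h with rfl | ⟨c, -, hc⟩
    · simp [curtainDist_self]
    · rcases Nat.eq_zero_or_pos n with rfl | hn
      · simp [curtainDist_self]
      · exact (Curtain.disjoint_negHalf_posHalf (hc 0 hn).1 (hc 0 hn).2).elim
  · linarith [h.add_one_le hxy]

theorem exists_hasLTower (L : ℕ) {x y : X} (hxy : x ≠ y) :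
    ∃ n : ℕ, HasLTower L n x y ∧ curtainDist L x y = n + 1 := by
  refine ⟨_, mem_separatingLengths.1 (Nat.sSup_mem (s := separatingLengths L x y)
    ⟨0, mem_separatingLengths.2 (Or.inl rfl)⟩ (bddAbove_separatingLengths L x y)), ?_⟩
  rw [curtainDist, if_neg hxy, add_comm]

theorem HasLTower.symm {L n : ℕ} {x y : X} (h : HasLTower L n x y) : HasLTower L n y x := by
  rcases h with rfl | ⟨c, hc, hxy⟩
  · exact Or.inl rfl
  · refine Or.inr ⟨_, hc.reverse, fun i hi => ?_⟩
    rw [Curtain.negHalf_reverse, Curtain.posHalf_reverse]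
    exact (hxy _ (by omega)).symm

/-- Cut the tower at the first curtain without `y` on its positive side. Only this curtain can be
lost: all later ones have `y` on their negative side by nesting. -/
theorem HasLTower.split {L n : ℕ} {x z : X} (h : HasLTower L n x z) (y : X) :
    ∃ a b, HasLTower L a x y ∧ HasLTower L b y z ∧ n ≤ a + b + 1 := by
  classical
  rcases h with rfl | ⟨c, hc, hxz⟩
  · exact ⟨0, 0, Or.inl rfl, Or.inl rfl, by omega⟩
  by_cases hall : ∀ i < n, y ∈ (c i).posHalf
  · exact ⟨n, 0, Or.inr ⟨c, hc, fun i hi => ⟨(hxz i hi).1, hall i hi⟩⟩, Or.inl rfl, by omega⟩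
  push Not at hall
  obtain ⟨ha, hya⟩ := Nat.find_spec hall
  have hmin : ∀ i < Nat.find hall, y ∈ (c i).posHalf := fun i hi => by
    by_contra hcon
    exact Nat.find_min hall hi ⟨by omega, hcon⟩
  set a := Nat.find hall
  refine ⟨a, n - (a + 1), Or.inr ⟨c, ⟨fun i j hij hj => hc.below i j hij (by omega),
    fun i j hij hj => hc.sep i j hij (by omega)⟩, fun i hi => ⟨(hxz i (by omega)).1, hmin i hi⟩⟩,
    Or.inr ⟨_, hc.shift (a + 1) (by omega), fun i hi => ⟨?_, (hxz _ (by omega)).2⟩⟩, by omega⟩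
  exact hc.below a _ (by omega) (by omega) (Curtain.notMem_posHalf.1 hya)

theorem curtainDist_comm (L : ℕ) (x y : X) : curtainDist L x y = curtainDist L y x := by
  have : separatingLengths L x y = separatingLengths L y x := by
    ext n
    rw [mem_separatingLengths, mem_separatingLengths]
    exact ⟨HasLTower.symm, HasLTower.symm⟩
  by_cases hxy : x = y
  · rw [hxy]
  · rw [curtainDist, curtainDist, if_neg hxy, if_neg (Ne.symm hxy), this]

theorem curtainDist_triangle (L : ℕ) (x y z : X) :
    curtainDist L x z ≤ curtainDist L x y + curtainDist L y z := by
  by_cases hxz : x = z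
  · subst hxz
    rw [curtainDist_self]
    exact add_nonneg (curtainDist_nonneg _ _ _) (curtainDist_nonneg _ _ _)
  by_cases hxy : x = y
  · subst hxy; rw [curtainDist_self, zero_add]
  by_cases hyz : y = z
  · subst hyz; rw [curtainDist_self, add_zero]
  obtain ⟨n, hn, hd⟩ := exists_hasLTower L hxz
  obtain ⟨a, b, ha, hb, hab⟩ := hn.split y
  have h1 := ha.add_one_le hxy
  have h2 := hb.add_one_le hyz
  have h3 : (n : ℝ) ≤ a + b + 1 := by exact_mod_cast hab
  linarith

theorem curtainDist_le_dist (L : ℕ) (x y : X) : curtainDist L x y ≤ dist x y + 3 := by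
  by_cases hxy : x = y
  · rw [hxy, curtainDist_self, dist_self]; norm_num
  · obtain ⟨n, hn, hd⟩ := exists_hasLTower L hxy
    linarith [hn.le_dist]

theorem isMetric_curtainDist (L : ℕ) : IsMetric (curtainDist (X := X) L) :=
  ⟨{  dist := curtainDist L
      dist_self := curtainDist_self L
      dist_comm := curtainDist_comm L
      dist_triangle := curtainDist_triangle L
      eq_of_dist_eq_zero := fun {x y} h => by
        by_contra hxy
        have := one_le_curtainDist L hxy
        change curtainDist L x y = 0 at h
        linarith }, fun _ _ => rfl⟩

theorem curtainDist_mono {L M : ℕ} (hLM : L ≤ M) (x y : X) :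
    curtainDist L x y ≤ curtainDist M x y := by
  by_cases hxy : x = y
  · rw [hxy, curtainDist_self, curtainDist_self]
  obtain ⟨n, hn, hd⟩ := exists_hasLTower L hxy
  rw [hd]
  refine HasLTower.add_one_le ?_ hxy
  rcases hn with rfl | ⟨c, hc, hs⟩
  · exact Or.inl rfl
  · exact Or.inr ⟨c, ⟨hc.below, fun i j hij hj => ⟨(hc.sep i j hij hj).1,
      fun m e he hm => ((hc.sep i j hij hj).2 m e he hm).trans hLM⟩⟩, hs⟩

theorem actionDominates_curtainDist {L M : ℕ} (hLM : L ≤ M) :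
    ActionDominates (isometryGroup (fun x y : X => dist x y))
      (curtainDist (X := X) M) (curtainDist (X := X) L) :=
  ⟨id, fun _ _ => rfl, 1, fun x y => by
    have := curtainDist_mono hLM x y
    simp only [id]; linarith⟩

end CurtainMetric

/-! ### Replacing blocks of a tower by curtains dual to a geodesic. -/

section Dualising

variable {X : Type*} [MetricSpace X]

theorem Icc_subset_interior_of_lt {I : Set ℝ} (hI : I.OrdConnected) {a b s t : ℝ} (hs : s ∈ I)
    (ht : t ∈ I) (hsa : s < a) (hbt : b < t) : Icc a b ⊆ interior I := fun u hu => by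
  have : Ioo s t ⊆ interior I :=
    interior_maximal (Ioo_subset_Icc_self.trans (hI.out hs ht)) isOpen_Ioo
  exact this ⟨by linarith [hu.1], by linarith [hu.2]⟩

/-- The curtain dual to the geodesic `α` at `r`. -/
def IsClosedGeodesic.curtain {α : ℝ → X} {I : Set ℝ} (h : IsClosedGeodesic α I) (r : ℝ)
    (hr : Icc (r - 1 / 2) (r + 1 / 2) ⊆ interior I) : Curtain X :=
  ⟨I, α, r, h.isClosed, h.isGeodesicOn, hr⟩

section DualCurtains

variable {α : ℝ → X} {I : Set ℝ} (h : IsClosedGeodesic α I) {r r' : ℝ}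
  (hr : Icc (r - 1 / 2) (r + 1 / 2) ⊆ interior I) (hr' : Icc (r' - 1 / 2) (r' + 1 / 2) ⊆ interior I)

namespace IsClosedGeodesic

theorem mem_lower_curtain {x : X} : x ∈ (h.curtain r hr).lower ↔ foot α I x ≤ r + 1 / 2 := Iff.rfl

theorem mem_upper_curtain {x : X} : x ∈ (h.curtain r hr).upper ↔ r - 1 / 2 ≤ foot α I x := Iff.rfl

variable [CAT0Space X]

theorem mem_negHalf_curtain {x : X} : x ∈ (h.curtain r hr).negHalf ↔ foot α I x < r - 1 / 2 :=
  Curtain.mem_negHalf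

theorem curtain_below (hrr : r + 1 < r') : (h.curtain r hr).Below (h.curtain r' hr') := fun x hx =>
  (h.mem_negHalf_curtain hr').2 (by rw [mem_lower_curtain] at hx; linarith)

end IsClosedGeodesic

end DualCurtains

variable [CAT0Space X]

/-- If two `L`-separated curtains both project onto `[a, b]`, then `b - a` is at most `L + 1`. -/
theorem IsClosedGeodesic.sub_le_of_lSeparated {β : ℝ → X} {J : Set ℝ} (hβ : IsClosedGeodesic β J)
    {L : ℕ} {h k : Curtain X} (hs : LSeparated L h k) {a b : ℝ} {u₁ u₂ v₁ v₂ : X}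
    (hu₁ : u₁ ∈ h.carrier) (hu₂ : u₂ ∈ h.carrier) (hv₁ : v₁ ∈ k.carrier) (hv₂ : v₂ ∈ k.carrier)
    (au₁ : foot β J u₁ ≤ a) (au₂ : b ≤ foot β J u₂) (av₁ : foot β J v₁ ≤ a)
    (av₂ : b ≤ foot β J v₂) : b - a ≤ L + 1 := by
  by_contra hcon
  push Not at hcon
  -- Cut `[a, b]` into `L + 1` pieces of length `δ > 1`. The curtains dual to their midpoints form a
  -- chain that is one too long.
  set δ := (b - a) / (L + 1) with hδ
  have hδ1 : 1 < δ := by rw [hδ, lt_div_iff₀ (by positivity)]; linarith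
  have hδL : (L + 1) * δ = b - a := by rw [hδ]; field_simp
  set r : ℕ → ℝ := fun i => a + (i + 1 / 2) * δ with hr
  have hra : ∀ i, a < r i - 1 / 2 := fun i => by
    simp only [hr]; nlinarith [mul_nonneg (Nat.cast_nonneg (α := ℝ) i) (by linarith : 0 ≤ δ)]
  have hrb : ∀ i ≤ L, r i + 1 / 2 < b := fun i hi => by
    have : (i : ℝ) * δ ≤ L * δ := by gcongr
    simp only [hr]; nlinarith
  have hpole : ∀ i ≤ L, Icc (r i - 1 / 2) (r i + 1 / 2) ⊆ interior J := fun i hi =>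
    Icc_subset_interior_of_lt hβ.isGeodesicOn.1 (hβ.foot_mem u₁) (hβ.foot_mem u₂)
      (au₁.trans_lt (hra i)) ((hrb i hi).trans_le au₂)
  let c : Fin (L + 1) → Curtain X := fun i => hβ.curtain (r i) (hpole i (by omega))
  have hlt : ∀ i j : Fin (L + 1), i < j → (c i).Below (c j) := fun i j hij => by
    refine hβ.curtain_below _ _ ?_
    have : ((i : ℕ) : ℝ) + 1 ≤ ((j : ℕ) : ℝ) := by exact_mod_cast hij
    simp only [hr]; nlinarith
  have hchain : IsCurtainChain c := by
    refine ⟨fun i j hij => ?_, fun i j k hij hjk => Or.inl ⟨?_, ?_⟩⟩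
    · rcases lt_or_gt_of_ne hij with h | h
      · exact (hlt i j h).disjoint
      · exact (hlt j i h).disjoint.symm
    · exact (c i).carrier_subset_lower.trans (hlt i j (by rw [Fin.lt_def]; omega))
    · exact (c k).carrier_subset_upper.trans (hlt j k (by rw [Fin.lt_def]; omega)).upper_subset
  have hmeet : ∀ (m : Curtain X) (x y : X), x ∈ m.carrier → y ∈ m.carrier → foot β J x ≤ a →
      b ≤ foot β J y → ∀ i, (c i).Meets m := fun m x y hx hy hxa hyb i => by
    rw [Curtain.Meets, inter_comm]
    refine Curtain.exists_mem_carrier m.isPreconnected_carrier hx hy ?_ ?_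
    · rw [hβ.mem_lower_curtain]; linarith [hra i]
    · rw [hβ.mem_upper_curtain]; linarith [hrb i (by omega)]
  have := hs.2 _ c hchain fun i => ⟨hmeet h u₁ u₂ hu₁ hu₂ au₁ au₂ i, hmeet k v₁ v₂ hv₁ hv₂ av₁ av₂ i⟩
  omega

theorem IsLTower.exists_mem_carrier_of_geodesic {L n : ℕ} {c : ℕ → Curtain X} (hc : IsLTower L c n)
    {α : ℝ → X} {I : Set ℝ} (hα : IsGeodesicOn α I) {s t : ℝ} (hs : s ∈ I) (ht : t ∈ I) {i j k : ℕ}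
    (hij : i < j) (hjk : j < k) (hk : k < n) (hsi : α s ∈ (c i).lower) (htk : α t ∈ (c k).upper) :
    ∃ u ∈ uIcc s t, α u ∈ (c j).carrier := by
  have h1 := hc.below i j hij (by omega) hsi
  have h2 := (hc.below j k hjk hk).upper_subset htk
  rw [Curtain.mem_negHalf] at h1
  rw [Curtain.mem_posHalf] at h2
  obtain ⟨u, hu, huv⟩ := hα.exists_eq (c j).continuous_coord hs ht (v := (c j).r)
    (by linarith) (by linarith)
  exact ⟨u, hu, Curtain.mem_carrier.2 ⟨by linarith, by linarith⟩⟩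

/-- The projection of the negative side of a tower to a geodesic crossing the tower does not reach
far into the tower. -/
theorem IsLTower.foot_mem_lower {L n : ℕ} {c : ℕ → Curtain X} (hc : IsLTower L c n)
    (hn : L + 6 ≤ n) {α : ℝ → X} {I : Set ℝ} (hα : IsClosedGeodesic α I) {s t : ℝ} (hs : s ∈ I)
    (ht : t ∈ I) (hsc : α s ∈ (c 0).lower) (htc : α t ∈ (c (n - 1)).upper) {u : X}
    (hu : u ∈ (c 0).lower) : α (foot α I u) ∈ (c (L + 5)).lower := by
  by_contra hcon
  have hp : α (foot α I u) ∈ (c (L + 5)).upper :=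
    Curtain.posHalf_subset_upper _ (not_not.1 (mt Curtain.notMem_posHalf.1 hcon))
  -- The geodesic `β` is perpendicular to `α`, so all of `α` projects to its starting point.
  obtain ⟨β, hβ, h0, h1⟩ := CAT0Space.exists_isGeodesicOn (α (foot α I u)) u
  set D := dist (α (foot α I u)) u
  have hD : 0 ≤ D := dist_nonneg
  have hcross : ∀ j, 0 < j → j < L + 5 → ∃ v ∈ Icc 0 D, β v ∈ (c j).carrier := fun j hj hjL => by
    obtain ⟨v, hv, hvj⟩ := hc.exists_mem_carrier_of_geodesic hβ.isGeodesicOn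
      (right_mem_Icc.2 hD) (left_mem_Icc.2 hD) hj hjL (by omega) (by rwa [h1]) (by rwa [h0])
    exact ⟨v, by rwa [uIcc_of_ge hD] at hv, hvj⟩
  have hcross' : ∀ j, 0 < j → j < n - 1 → ∃ v ∈ I, α v ∈ (c j).carrier := fun j hj hjn => by
    obtain ⟨v, hv, hvj⟩ := hc.exists_mem_carrier_of_geodesic hα.isGeodesicOn hs ht hj hjn
      (by omega) hsc htc
    exact ⟨v, hα.isGeodesicOn.1.uIcc_subset hs ht hv, hvj⟩
  -- The curtains between `c 2` and `c (L + 5)` keep these points at distance at least `L + 2` from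
  -- the start of `β`, just above the permitted `L + 1`.
  have hdist : ∀ j, j ≤ 2 → ∀ v ∈ Icc 0 D, β v ∈ (c j).carrier →
      (L : ℝ) + 5 - 2 - 1 ≤ foot β (Icc 0 D) (β v) := fun j hj v hv hvj => by
    have := hc.sub_le_dist (i := j) (j := L + 5) (by omega) (by omega)
      ((c j).carrier_subset_lower hvj) hp
    rw [← h0, dist_comm, hβ.isGeodesicOn.dist_eq (left_mem_Icc.2 hD) hv hv.1] at this
    rw [hβ.foot_apply hv]
    have hj' : (j : ℝ) ≤ 2 := by exact_mod_cast hj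
    push_cast at this
    linarith
  -- two adjacent curtains both cross from `α` to the far part of `β`
  obtain ⟨v₁, hv₁, hv₁c⟩ := hcross 1 (by omega) (by omega)
  obtain ⟨v₂, hv₂, hv₂c⟩ := hcross 2 (by omega) (by omega)
  obtain ⟨w₁, hw₁, hw₁c⟩ := hcross' 1 (by omega) (by omega)
  obtain ⟨w₂, hw₂, hw₂c⟩ := hcross' 2 (by omega) (by omega)
  have := hβ.sub_le_of_lSeparated (hc.sep 1 2 (by omega) (by omega)) hw₁c hv₁c hw₂c hv₂c
    (hα.foot_perp hβ h0 h1 hw₁).le (hdist 1 (by omega) v₁ hv₁ hv₁c)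
    (hα.foot_perp hβ h0 h1 hw₂).le (hdist 2 (by omega) v₂ hv₂ hv₂c)
  linarith

theorem IsLTower.foot_mem_upper {L n : ℕ} {c : ℕ → Curtain X} (hc : IsLTower L c n)
    (hn : L + 6 ≤ n) {α : ℝ → X} {I : Set ℝ} (hα : IsClosedGeodesic α I) {s t : ℝ} (hs : s ∈ I)
    (ht : t ∈ I) (hsc : α s ∈ (c 0).lower) (htc : α t ∈ (c (n - 1)).upper) {u : X}
    (hu : u ∈ (c (n - 1)).upper) : α (foot α I u) ∈ (c (n - 1 - (L + 5))).upper := by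
  have := hc.reverse.foot_mem_lower hn hα ht hs (by simpa [Curtain.lower_reverse] using htc)
    (by rw [Curtain.upper_reverse, Nat.sub_self]; exact hsc) (u := u)
    (by simpa [Curtain.lower_reverse] using hu)
  rwa [Curtain.lower_reverse] at this

/-- A geodesic that has crossed a long part of a tower does not come back. -/
theorem IsLTower.not_backtrack {L n : ℕ} {c : ℕ → Curtain X} (hc : IsLTower L c n) {p q : ℕ}
    (hpq : p + L + 5 ≤ q) (hq : q < n) {α : ℝ → X} {I : Set ℝ} (hα : IsClosedGeodesic α I)
    {r s t : ℝ} (hr : r ∈ I) (ht : t ∈ I) (hrs : r ≤ s) (hst : s ≤ t)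
    (hrc : α r ∈ (c p).lower) (hsc : α s ∈ (c q).upper) (htc : α t ∈ (c p).lower) : False := by
  have hs : s ∈ I := hα.isGeodesicOn.1.out hr ht ⟨hrs, hst⟩
  have cross : ∀ j, p < j → j < q → (∃ v ∈ Icc r s, α v ∈ (c j).carrier) ∧
      ∃ v ∈ Icc s t, α v ∈ (c j).carrier := fun j hj hjq => by
    obtain ⟨v, hv, hvj⟩ := hc.exists_mem_carrier_of_geodesic hα.isGeodesicOn hr hs hj hjq hq hrc hsc
    obtain ⟨w, hw, hwj⟩ := hc.exists_mem_carrier_of_geodesic hα.isGeodesicOn ht hs hj hjq hq htc hsc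
    exact ⟨⟨v, by rwa [uIcc_of_le hrs] at hv, hvj⟩, ⟨w, by rwa [uIcc_of_ge hst] at hw, hwj⟩⟩
  -- Here `α` is projected to itself: on the way back the curtains `c (p + 1)` and `c (p + 2)` are
  -- met after `s + (L + 2)`, and on the way out before `s`.
  have far : ∀ j, j ≤ p + 2 → ∀ v ∈ Icc s t, α v ∈ (c j).carrier →
      s + (L + 2) ≤ foot α I (α v) := fun j hj v hv hvj => by
    have hvI : v ∈ I := hα.isGeodesicOn.1.out hs ht hv
    have h1 := hc.sub_le_dist (i := j) (j := q) (by omega) hq ((c j).carrier_subset_lower hvj) hsc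
    rw [dist_comm, hα.isGeodesicOn.dist_eq hs hvI hv.1] at h1
    rw [hα.foot_apply hvI]
    have h2 : (j : ℝ) ≤ p + 2 := by exact_mod_cast hj
    have h3 : (p : ℝ) + L + 5 ≤ q := by exact_mod_cast hpq
    linarith
  have near : ∀ v ∈ Icc r s, foot α I (α v) ≤ s := fun v hv => by
    rw [hα.foot_apply (hα.isGeodesicOn.1.out hr hs hv)]; exact hv.2
  obtain ⟨⟨v₁, hv₁, hv₁c⟩, w₁, hw₁, hw₁c⟩ := cross (p + 1) (by omega) (by omega)
  obtain ⟨⟨v₂, hv₂, hv₂c⟩, w₂, hw₂, hw₂c⟩ := cross (p + 2) (by omega) (by omega)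
  have := hα.sub_le_of_lSeparated (hc.sep (p + 1) (p + 2) (by omega) (by omega)) hv₁c hw₁c hv₂c hw₂c
    (near v₁ hv₁) (far _ (by omega) w₁ hw₁ hw₁c) (near v₂ hv₂) (far _ (by omega) w₂ hw₂ hw₂c)
  linarith

theorem IsLTower.not_backtrack' {L n : ℕ} {c : ℕ → Curtain X} (hc : IsLTower L c n) {p q : ℕ}
    (hpq : p + L + 5 ≤ q) (hq : q < n) {α : ℝ → X} {I : Set ℝ} (hα : IsClosedGeodesic α I)
    {r s t : ℝ} (hr : r ∈ I) (ht : t ∈ I) (hrs : r ≤ s) (hst : s ≤ t)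
    (hrc : α r ∈ (c q).upper) (hsc : α s ∈ (c p).lower) (htc : α t ∈ (c q).upper) : False := by
  refine hc.reverse.not_backtrack (p := n - 1 - q) (q := n - 1 - p) (by omega) (by omega) hα hr ht
    hrs hst ?_ ?_ ?_
  · rw [Curtain.lower_reverse, show n - 1 - (n - 1 - q) = q by omega]; exact hrc
  · rw [Curtain.upper_reverse, show n - 1 - (n - 1 - p) = p by omega]; exact hsc
  · rw [Curtain.lower_reverse, show n - 1 - (n - 1 - q) = q by omega]; exact htc

/-- A geodesic crossing a long tower has a dual curtain that fits inside the tower. -/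
theorem IsLTower.exists_dual_curtain {L : ℕ} {c : ℕ → Curtain X} (hc : IsLTower L c (3 * L + 16))
    {α : ℝ → X} {I : Set ℝ} (hα : IsClosedGeodesic α I) {s t : ℝ} (hs : s ∈ I) (ht : t ∈ I)
    (hst : s ≤ t) (hsc : α s ∈ (c 0).lower) (htc : α t ∈ (c (3 * L + 15)).upper) :
    ∃ r, ∃ hr : Icc (r - 1 / 2) (r + 1 / 2) ⊆ interior I, s < r - 1 / 2 ∧ r + 1 / 2 < t ∧
      (c 0).Below (hα.curtain r hr) ∧ (hα.curtain r hr).Below (c (3 * L + 15)) := by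
  -- Three stretches of `L + 5` curtains: the outer two absorb the spread of the two projections,
  -- and the middle one separates the feet by at least `L + 4`. Feet in the wrong order would make
  -- `α` backtrack across the middle stretch.
  have gap : ∀ u ∈ (c 0).lower, ∀ v ∈ (c (3 * L + 15)).upper, foot α I u + 2 ≤ foot α I v := by
    intro u hu v hv
    have h1 := hc.foot_mem_lower (by omega) hα hs ht hsc htc hu
    have h2 := hc.foot_mem_upper (by omega) hα hs ht hsc htc hv
    rw [show 3 * L + 16 - 1 - (L + 5) = 2 * L + 10 by omega] at h2
    have h3 := hc.sub_le_dist (by omega) (by omega) h1 h2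
    push_cast at h3
    by_contra hcon
    push Not at hcon
    rcases le_total (foot α I u) (foot α I v) with h | h
    · rw [hα.isGeodesicOn.dist_eq (hα.foot_mem u) (hα.foot_mem v) h] at h3
      linarith [Nat.cast_nonneg (α := ℝ) L]
    · have hs' := (hc.below 0 (L + 5) (by omega) (by omega)).lower_subset hsc
      have ht' := (hc.below (2 * L + 10) (3 * L + 15) (by omega) (by omega)).upper_subset htc
      rcases le_total s (foot α I v) with h' | h'
      · exact hc.not_backtrack (by omega) (by omega) hα hs (hα.foot_mem u) h' h hs' h2 h1
      · exact hc.not_backtrack' (by omega) (by omega) hα (hα.foot_mem v) ht h' hst h2 hs'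
          (Curtain.posHalf_subset_upper _ ht')
  set S := foot α I '' (c 0).lower
  have hSne : S.Nonempty := ⟨_, _, hsc, rfl⟩
  have hbound : ∀ v ∈ (c (3 * L + 15)).upper, sSup S + 2 ≤ foot α I v := fun v hv => by
    have : sSup S ≤ foot α I v - 2 := csSup_le hSne (by
      rintro _ ⟨u, hu, rfl⟩; linarith [gap u hu v hv])
    linarith
  have hle : ∀ u ∈ (c 0).lower, foot α I u ≤ sSup S := fun u hu =>
    le_csSup ⟨foot α I (α t) - 2, by rintro _ ⟨u, hu, rfl⟩; linarith [gap u hu _ htc]⟩ ⟨u, hu, rfl⟩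
  have h1 := hle _ hsc
  have h2 := hbound _ htc
  rw [hα.foot_apply hs] at h1
  rw [hα.foot_apply ht] at h2
  have hr : Icc (sSup S + 1 - 1 / 2) (sSup S + 1 + 1 / 2) ⊆ interior I :=
    Icc_subset_interior_of_lt hα.isGeodesicOn.1 hs ht (by linarith) (by linarith)
  -- The gap of 2 leaves room for a pole of length 1 with margin 1/2 on either side.
  refine ⟨sSup S + 1, hr, by linarith, by linarith, fun u hu => ?_, fun v hv => ?_⟩
  · rw [hα.mem_negHalf_curtain]; linarith [hle u hu]
  · by_contra hcon
    have := hbound v (Curtain.notMem_negHalf.1 hcon)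
    rw [hα.mem_lower_curtain] at hv
    linarith

end Dualising

/-! ### Coarse additivity, contraction and thin geodesic triangles. -/

section Bottleneck

variable {X : Type*} [MetricSpace X] [CAT0Space X]

/-- The curtain metric is additive along geodesics, up to a bounded error. -/
theorem IsGeodesicOn.curtainDist_add_le (L : ℕ) {α : ℝ → X} {I : Set ℝ} (hα : IsGeodesicOn α I)
    {s t u : ℝ} (hs : s ∈ I) (hu : u ∈ I) (hst : s ≤ t) (htu : t ≤ u) :
    curtainDist L (α s) (α t) + curtainDist L (α t) (α u) ≤
      curtainDist L (α s) (α u) + (6 * L + 34) := by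
  have hL : (0 : ℝ) ≤ L := Nat.cast_nonneg L
  by_cases hxy : α s = α t
  · rw [hxy, curtainDist_self]; linarith
  by_cases hyz : α t = α u
  · rw [hyz, curtainDist_self]; linarith
  obtain ⟨n, hn, hdn⟩ := exists_hasLTower L hxy
  obtain ⟨m, hm, hdm⟩ := exists_hasLTower L hyz
  have t1 := curtainDist_triangle L (α t) (α s) (α u)
  have t2 := curtainDist_triangle L (α s) (α u) (α t)
  rw [curtainDist_comm L (α t) (α s)] at t1
  rw [curtainDist_comm L (α u) (α t)] at t2
  -- If one tower is short, its distance is at most `3 * L + 17`, and the triangle inequality costs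
  -- twice that.
  rcases le_or_gt n (3 * L + 16) with hnM | hnM
  · have : (n : ℝ) ≤ 3 * L + 16 := by exact_mod_cast hnM
    linarith
  rcases le_or_gt m (3 * L + 16) with hmM | hmM
  · have : (m : ℝ) ≤ 3 * L + 16 := by exact_mod_cast hmM
    linarith
  obtain ⟨c, hc, hcx⟩ := hn.resolve_left (by omega)
  obtain ⟨e, he, hex⟩ := hm.resolve_left (by omega)
  have hβ : IsClosedGeodesic α (Icc s u) := hα.isClosedGeodesic_Icc hs hu (hst.trans htu)
  have hs' : s ∈ Icc s u := ⟨le_rfl, hst.trans htu⟩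
  have ht' : t ∈ Icc s u := ⟨hst, htu⟩
  have hu' : u ∈ Icc s u := ⟨hst.trans htu, le_rfl⟩
  -- The last block of `c` and the first block of `e` yield curtains dual to `α` before and after
  -- `t`. These are nested, which orders the rest of `c` below the rest of `e`.
  obtain ⟨r, hr, hsr, hrt, hcr, -⟩ := (hc.shift (n - (3 * L + 16))
    (m := 3 * L + 16) (by omega)).exists_dual_curtain hβ hs' ht' hst
    (Curtain.negHalf_subset_lower _ (hcx _ (by omega)).1)
    (Curtain.posHalf_subset_upper _ (hcx _ (by omega)).2)
  obtain ⟨r', hr', htr', hru', -, hre⟩ := (he.shift 0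
    (m := 3 * L + 16) (by omega)).exists_dual_curtain hβ ht' hu' htu
    (Curtain.negHalf_subset_lower _ (hex _ (by omega)).1)
    (Curtain.posHalf_subset_upper _ (hex _ (by omega)).2)
  rw [add_zero] at hcr
  rw [zero_add] at hre
  have hrr : (hβ.curtain r hr).Below (hβ.curtain r' hr') := hβ.curtain_below hr hr' (by linarith)
  have hmid : (c (n - (3 * L + 16))).Below (e (3 * L + 15)) := (hcr.trans hrr).trans hre
  have huk : α u ∈ (hβ.curtain r hr).upper := by
    rw [hβ.mem_upper_curtain, hβ.foot_apply hu']; linarith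
  have hsk : α s ∈ (hβ.curtain r' hr').lower := by
    rw [hβ.mem_lower_curtain, hβ.foot_apply hs']; linarith
  set N := n - (3 * L + 16) with hN
  -- Both blocks are dropped whole. The discarded curtain `c N` still lies between the two parts and
  -- makes them `L`-separated from each other.
  set f : ℕ → Curtain X := fun i => if i < N then c i else e (3 * L + 16 + (i - N)) with hf
  have hf1 : ∀ i, i < N → f i = c i := fun i hi => if_pos hi
  have hf2 : ∀ i, N ≤ i → f i = e (3 * L + 16 + (i - N)) := fun i hi => if_neg (by omega)
  have htower : IsLTower L f (N + (m - (3 * L + 16))) := by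
    constructor
    · intro i j hij hj
      rcases lt_or_ge j N with h | h
      · rw [hf1 i (by omega), hf1 j h]; exact hc.below _ _ hij (by omega)
      · rcases lt_or_ge i N with h' | h'
        · rw [hf1 i h', hf2 j h]
          exact ((hc.below i N h' (by omega)).trans hmid).trans (he.below _ _ (by omega) (by omega))
        · rw [hf2 i h', hf2 j h]; exact he.below _ _ (by omega) (by omega)
    · intro i j hij hj
      rcases lt_or_ge j N with h | h
      · rw [hf1 i (by omega), hf1 j h]; exact hc.sep _ _ hij (by omega)
      · rcases lt_or_ge i N with h' | h'
        · rw [hf1 i h', hf2 j h]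
          exact (hc.below i N h' (by omega)).lSeparated_right
            (hmid.trans (he.below _ _ (by omega) (by omega))) (hc.sep i N h' (by omega))
        · rw [hf2 i h', hf2 j h]; exact he.sep _ _ (by omega) (by omega)
  have hfinal : HasLTower L (N + (m - (3 * L + 16))) (α s) (α u) := by
    refine Or.inr ⟨f, htower, fun i hi => ?_⟩
    rcases lt_or_ge i N with h | h
    · rw [hf1 i h]
      exact ⟨(hcx i (by omega)).1, ((hc.below i N h (by omega)).trans hcr).upper_subset huk⟩
    · rw [hf2 i h]
      exact ⟨(hre.trans (he.below _ _ (by omega) (by omega))) hsk, (hex _ (by omega)).2⟩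
  have hle := hfinal.le_curtainDist
  have hcast : (n : ℝ) + m ≤ (N + (m - (3 * L + 16)) : ℕ) + (6 * L + 32) := by
    exact_mod_cast (by omega : n + m ≤ N + (m - (3 * L + 16)) + (6 * L + 32))
  linarith

theorem IsClosedGeodesic.mem_carrier_curtain {α : ℝ → X} {I : Set ℝ} (h : IsClosedGeodesic α I)
    {r : ℝ} (hr : Icc (r - 1 / 2) (r + 1 / 2) ⊆ interior I) {x : X} (hx : foot α I x = r) :
    x ∈ (h.curtain r hr).carrier :=
  Curtain.mem_carrier_of_lower_upper (by rw [h.mem_lower_curtain]; linarith)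
    (by rw [h.mem_upper_curtain]; linarith)

theorem IsClosedGeodesic.foot_apply_of_pole {α : ℝ → X} {I : Set ℝ} (h : IsClosedGeodesic α I)
    {r : ℝ} (hr : Icc (r - 1 / 2) (r + 1 / 2) ⊆ interior I) : foot α I (α r) = r :=
  h.foot_apply (interior_subset (hr ⟨by linarith, by linarith⟩))

/-- A geodesic crossing three pairwise `L`-separated curtains dual to a geodesic `α` passes close
to `α`. -/
theorem IsClosedGeodesic.dist_le_of_lSeparated {L : ℕ} {α : ℝ → X} {I : Set ℝ}
    (h : IsClosedGeodesic α I) {r₁ r₂ r₃ : ℝ}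
    (h₁ : Icc (r₁ - 1 / 2) (r₁ + 1 / 2) ⊆ interior I)
    (h₂ : Icc (r₂ - 1 / 2) (r₂ + 1 / 2) ⊆ interior I)
    (h₃ : Icc (r₃ - 1 / 2) (r₃ + 1 / 2) ⊆ interior I) (h12 : r₁ ≤ r₂) (h23 : r₂ ≤ r₃)
    (hs12 : LSeparated L (h.curtain r₁ h₁) (h.curtain r₂ h₂))
    (hs23 : LSeparated L (h.curtain r₂ h₂) (h.curtain r₃ h₃)) {γ : ℝ → X} {J : Set ℝ}
    (hγ : IsGeodesicOn γ J) {a b w : ℝ} (ha : a ∈ J) (hb : b ∈ J) (hw : w ∈ uIcc a b)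
    (hfa : foot α I (γ a) ≤ r₁) (hfw : foot α I (γ w) = r₂) (hfb : r₃ ≤ foot α I (γ b)) :
    dist (γ w) (α r₂) ≤ L + 1 := by
  have hwJ : w ∈ J := hγ.1.uIcc_subset ha hb hw
  -- On the perpendicular `β` from `α r₂` to `γ w`, the poles on `α` project to the start and one of
  -- the two halves of `γ` projects to the end. So the middle curtain and one of its neighbours both
  -- project onto all of `β`.
  obtain ⟨β, hβ, h0, h1⟩ := CAT0Space.exists_isGeodesicOn (α r₂) (γ w)
  have perp : ∀ r, Icc (r - 1 / 2) (r + 1 / 2) ⊆ interior I →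
      foot β (Icc 0 (dist (α r₂) (γ w))) (α r) = 0 := fun r hr =>
    h.foot_perp hβ (by rw [h0, hfw]) h1 (interior_subset (hr ⟨by linarith, by linarith⟩))
  have hwf : foot β (Icc 0 (dist (α r₂) (γ w))) (γ w) = dist (α r₂) (γ w) := by
    have := hβ.foot_apply (right_mem_Icc.2 dist_nonneg)
    rwa [h1] at this
  rw [dist_comm]
  rcases IsClosedGeodesic.foot_eq_of_between_or hβ h1 (hγ.dist_add_dist ha hb hw) with hz | hz
  · obtain ⟨v, hv, hfv⟩ := hγ.exists_eq h.continuous_foot ha hwJ hfa (by rw [hfw]; exact h12)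
    have := hβ.sub_le_of_lSeparated hs12
      (h.mem_carrier_curtain h₁ (h.foot_apply_of_pole h₁)) (h.mem_carrier_curtain h₁ hfv)
      (h.mem_carrier_curtain h₂ (h.foot_apply_of_pole h₂)) (h.mem_carrier_curtain h₂ hfw)
      (perp r₁ h₁).le (hz _ (hγ.dist_add_dist ha hwJ hv)).ge (perp r₂ h₂).le hwf.ge
    linarith
  · obtain ⟨v, hv, hfv⟩ := hγ.exists_eq h.continuous_foot hwJ hb (by rw [hfw]; exact h23) hfb
    have := hβ.sub_le_of_lSeparated hs23
      (h.mem_carrier_curtain h₂ (h.foot_apply_of_pole h₂)) (h.mem_carrier_curtain h₂ hfw)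
      (h.mem_carrier_curtain h₃ (h.foot_apply_of_pole h₃)) (h.mem_carrier_curtain h₃ hfv)
      (perp r₂ h₂).le hwf.ge (perp r₃ h₃).le
      (hz _ (hγ.dist_add_dist hb hwJ (by rwa [uIcc_comm]))).ge
    linarith

theorem IsClosedGeodesic.lt_of_curtain_below {α : ℝ → X} {I : Set ℝ} (h : IsClosedGeodesic α I)
    {r r' : ℝ} {hr : Icc (r - 1 / 2) (r + 1 / 2) ⊆ interior I}
    {hr' : Icc (r' - 1 / 2) (r' + 1 / 2) ⊆ interior I}
    (hb : (h.curtain r hr).Below (h.curtain r' hr')) : r < r' := by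
  have : α r ∈ (h.curtain r hr).lower := by
    rw [h.mem_lower_curtain, h.foot_apply_of_pole hr]; linarith
  have := hb this
  rw [h.mem_negHalf_curtain, h.foot_apply_of_pole hr] at this
  linarith

/-- If the projection of a geodesic `γ` to a geodesic `α` contains `α [s, τ]`, and `α s` and `α τ`
are far apart in the curtain metric, then `γ` passes close to `α τ`. -/
theorem IsClosedGeodesic.exists_curtainDist_le {L : ℕ} {α : ℝ → X} {I : Set ℝ}
    (h : IsClosedGeodesic α I) {s τ : ℝ} (hs : s ∈ I) (hτ : τ ∈ I) (hsτ : s ≤ τ)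
    (hfar : 9 * L + 50 ≤ curtainDist L (α s) (α τ)) {γ : ℝ → X} {J : Set ℝ}
    (hγ : IsGeodesicOn γ J) {a b : ℝ} (ha : a ∈ J) (hb : b ∈ J)
    (hfa : foot α I (γ a) ≤ s) (hfb : τ ≤ foot α I (γ b)) :
    ∃ w ∈ uIcc a b, curtainDist L (γ w) (α τ) ≤ 16 * L + 87 := by
  have hne : α s ≠ α τ := fun heq => by
    rw [heq, curtainDist_self] at hfar
    linarith [Nat.cast_nonneg (α := ℝ) L]
  obtain ⟨n, hn, hd⟩ := exists_hasLTower L hne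
  have hnM : 9 * L + 49 ≤ n := by
    rw [hd] at hfar
    have : ((9 * L + 49 : ℕ) : ℝ) ≤ n := by push_cast; linarith
    exact_mod_cast this
  obtain ⟨c, hc, hcx⟩ := hn.resolve_left (by omega)
  have block : ∀ i, i + (3 * L + 16) ≤ n → ∃ r, ∃ hr : Icc (r - 1 / 2) (r + 1 / 2) ⊆ interior I,
      s < r - 1 / 2 ∧ r + 1 / 2 < τ ∧ (c i).Below (h.curtain r hr) ∧
      (h.curtain r hr).Below (c (i + (3 * L + 15))) := fun i hi => by
    have := (hc.shift i hi).exists_dual_curtain h hs hτ hsτ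
      (Curtain.negHalf_subset_lower _ (hcx _ (by omega)).1)
      (Curtain.posHalf_subset_upper _ (hcx _ (by omega)).2)
    simpa only [add_zero] using this
  -- The last three blocks, those nearest to `α τ`, become dual curtains. The other `m` curtains
  -- separate `α s` from `α r₂`, so by additivity `α r₂` is within `15 * L + 83` of `α τ`; passing
  -- from `γ w` to `α r₂` adds `L + 4`.
  obtain ⟨m, rfl⟩ : ∃ m, n = m + (9 * L + 48) := ⟨n - (9 * L + 48), by omega⟩
  obtain ⟨r₁, h₁, hs₁, ht₁, hc₁, hc₁'⟩ := block m (by omega)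
  obtain ⟨r₂, h₂, hs₂, ht₂, hc₂, hc₂'⟩ := block (m + (3 * L + 16)) (by omega)
  obtain ⟨r₃, h₃, hs₃, ht₃, hc₃, hc₃'⟩ := block (m + (6 * L + 32)) (by omega)
  have b12 := hc.below (m + (3 * L + 15)) (m + (3 * L + 16)) (by omega) (by omega)
  have b23 := hc.below (m + (3 * L + 16) + (3 * L + 15)) (m + (6 * L + 32)) (by omega) (by omega)
  have s12 := hc.sep (m + (3 * L + 15)) (m + (3 * L + 16)) (by omega) (by omega)
  have s23 := hc.sep (m + (3 * L + 16) + (3 * L + 15)) (m + (6 * L + 32)) (by omega) (by omega)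
  have l12 := h.lt_of_curtain_below ((hc₁'.trans b12).trans hc₂)
  have l23 := h.lt_of_curtain_below ((hc₂'.trans b23).trans hc₃)
  obtain ⟨w, hw, hfw⟩ := hγ.exists_eq h.continuous_foot ha hb (v := r₂) (by linarith) (by linarith)
  have hr₂ : r₂ ∈ I := interior_subset (h₂ ⟨by linarith, by linarith⟩)
  have hclose := h.dist_le_of_lSeparated h₁ h₂ h₃ l12.le l23.le
    (hc₁'.lSeparated_left (b12.trans hc₂) (b12.lSeparated_right hc₂ s12))
    (hc₂'.lSeparated_left (b23.trans hc₃) (b23.lSeparated_right hc₃ s23))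
    hγ ha hb hw (by linarith) hfw (by linarith)
  have hr₂u : α r₂ ∈ (h.curtain r₂ h₂).upper := by
    rw [h.mem_upper_curtain, h.foot_apply hr₂]; linarith
  have htower : HasLTower L m (α s) (α r₂) := Or.inr ⟨c,
    ⟨fun i j hij hj => hc.below i j hij (by omega), fun i j hij hj => hc.sep i j hij (by omega)⟩,
    fun i hi => ⟨(hcx i (by omega)).1,
      ((hc.below i (m + (3 * L + 16)) (by omega) (by omega)).trans hc₂).upper_subset hr₂u⟩⟩
  refine ⟨w, hw, ?_⟩
  have e1 := curtainDist_triangle L (γ w) (α r₂) (α τ)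
  have e2 := curtainDist_le_dist L (γ w) (α r₂)
  have e3 := h.isGeodesicOn.curtainDist_add_le L hs hτ (t := r₂) (by linarith) (by linarith)
  have e4 := htower.le_curtainDist
  push_cast at hd
  linarith

theorem IsClosedGeodesic.exists_curtainDist_le' {L : ℕ} {α : ℝ → X} {I : Set ℝ}
    (h : IsClosedGeodesic α I) {s τ : ℝ} (hs : s ∈ I) (hτ : τ ∈ I) (hsτ : s ≤ τ)
    (hfar : 9 * L + 50 ≤ curtainDist L (α s) (α τ)) {γ : ℝ → X} {J : Set ℝ}
    (hγ : IsGeodesicOn γ J) {a b : ℝ} (ha : a ∈ J) (hb : b ∈ J)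
    (hfa : foot α I (γ a) ≤ s) (hfb : τ ≤ foot α I (γ b)) :
    ∃ w ∈ uIcc a b, curtainDist L (γ w) (α s) ≤ 16 * L + 87 := by
  have := h.reverse.exists_curtainDist_le (L := L) (s := -τ) (τ := -s) (by simpa using hτ)
    (by simpa using hs) (by linarith) (by simpa [curtainDist_comm L (α τ)] using hfar) hγ hb ha
    (by rw [h.foot_reverse]; linarith) (by rw [h.foot_reverse]; linarith)
  rwa [uIcc_comm, neg_neg] at this

/-- The projection to a geodesic is contracting for the curtain metric. -/
theorem IsClosedGeodesic.curtainDist_foot_le {L : ℕ} {α : ℝ → X} {I : Set ℝ}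
    (h : IsClosedGeodesic α I) {x y : X}
    (hfar : 9 * L + 50 ≤ curtainDist L (α (foot α I x)) (α (foot α I y))) :
    curtainDist L x (α (foot α I x)) ≤ curtainDist L x y + (22 * L + 121) := by
  obtain ⟨γ, hγ, h0, h1⟩ := CAT0Space.exists_isGeodesicOn x y
  have hl := left_mem_Icc.2 (dist_nonneg (x := x) (y := y))
  have hr := right_mem_Icc.2 (dist_nonneg (x := x) (y := y))
  -- The geodesic from `x` to `y` passes near the foot of `x`; additivity along it then bounds the
  -- distance from `x` to that foot.
  obtain ⟨w, hw, hwd⟩ : ∃ w ∈ Icc 0 (dist x y),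
      curtainDist L (γ w) (α (foot α I x)) ≤ 16 * L + 87 := by
    rcases le_total (foot α I x) (foot α I y) with hxy | hxy
    · have := h.exists_curtainDist_le' (h.foot_mem x) (h.foot_mem y) hxy hfar hγ.isGeodesicOn hl hr
        (by rw [h0]) (by rw [h1])
      rwa [uIcc_of_le dist_nonneg] at this
    · rw [curtainDist_comm] at hfar
      have := h.exists_curtainDist_le (h.foot_mem y) (h.foot_mem x) hxy hfar hγ.isGeodesicOn hr hl
        (by rw [h1]) (by rw [h0])
      rwa [uIcc_of_ge dist_nonneg] at this
  have e1 := hγ.isGeodesicOn.curtainDist_add_le L hl hr hw.1 hw.2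
  rw [h0, h1] at e1
  linarith [curtainDist_triangle L x (γ w) (α (foot α I x)), curtainDist_nonneg L (γ w) y]

/-- Geodesic triangles of a CAT(0) space are thin for the curtain metric. -/
theorem exists_curtainDist_le_of_triangle (L : ℕ) {x y z : X} {α β γ : ℝ → X}
    (hα : IsClosedGeodesic α (Icc 0 (dist x y))) (hα0 : α 0 = x) (hα1 : α (dist x y) = y)
    (hβ : IsClosedGeodesic β (Icc 0 (dist y z))) (hβ0 : β 0 = y) (hβ1 : β (dist y z) = z)
    (hγ : IsClosedGeodesic γ (Icc 0 (dist z x))) (hγ0 : γ 0 = z) (hγ1 : γ (dist z x) = x)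
    {τ : ℝ} (hτ : τ ∈ Icc 0 (dist x y)) :
    (∃ t ∈ Icc 0 (dist y z), curtainDist L (α τ) (β t) ≤ 16 * L + 87) ∨
    ∃ t ∈ Icc 0 (dist z x), curtainDist L (α τ) (γ t) ≤ 16 * L + 87 := by
  have hL : (0 : ℝ) ≤ L := Nat.cast_nonneg L
  have l1 := left_mem_Icc.2 (dist_nonneg (x := x) (y := y))
  have r1 := right_mem_Icc.2 (dist_nonneg (x := x) (y := y))
  have l2 := left_mem_Icc.2 (dist_nonneg (x := y) (y := z))
  have r2 := right_mem_Icc.2 (dist_nonneg (x := y) (y := z))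
  have l3 := left_mem_Icc.2 (dist_nonneg (x := z) (y := x))
  have r3 := right_mem_Icc.2 (dist_nonneg (x := z) (y := x))
  have fx : foot α (Icc 0 (dist x y)) x = 0 := by
    have := hα.foot_apply l1; rwa [hα0] at this
  have fy : foot α (Icc 0 (dist x y)) y = dist x y := by
    have := hα.foot_apply r1; rwa [hα1] at this
  -- The foot of `z` decides which side is used: its projection covers the part of `α` between `τ`
  -- and an endpoint.
  rcases le_total τ (foot α (Icc 0 (dist x y)) z) with hz | hz
  · right
    rcases le_or_gt (9 * (L : ℝ) + 50) (curtainDist L (α 0) (α τ)) with hfar | hnear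
    · obtain ⟨w, hw, hwd⟩ := hα.exists_curtainDist_le l1 hτ hτ.1 hfar hγ.isGeodesicOn r3 l3
        (by rw [hγ1, fx]) (by rwa [hγ0])
      rw [uIcc_of_ge dist_nonneg] at hw
      exact ⟨w, hw, by rwa [curtainDist_comm]⟩
    · refine ⟨_, r3, ?_⟩
      rw [hγ1, ← hα0, curtainDist_comm]; linarith
  · left
    rcases le_or_gt (9 * (L : ℝ) + 50) (curtainDist L (α τ) (α (dist x y))) with hfar | hnear
    · obtain ⟨w, hw, hwd⟩ := hα.exists_curtainDist_le' hτ r1 hτ.2 hfar hβ.isGeodesicOn r2 l2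
        (by rwa [hβ1]) (by rw [hβ0, fy])
      rw [uIcc_of_ge dist_nonneg] at hw
      exact ⟨w, hw, by rwa [curtainDist_comm]⟩
    · refine ⟨_, l2, ?_⟩
      rw [hβ0, ← hα1]; linarith

end Bottleneck

/-! ### Stability of quasigeodesics near the image of a contracting map. -/

section Morse

variable {Y : Type*} {d : Y → Y → ℝ}

theorem IsQuasigeodesicFromTo.reverse {q T : ℝ} {γ : ℝ → Y} {x y : Y}
    (h : IsQuasigeodesicFromTo d q γ T x y) :
    IsQuasigeodesicFromTo d q (fun t => γ (T - t)) T y x := by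
  obtain ⟨hT, ⟨-, hq⟩, h0, h1⟩ := h
  refine ⟨hT, ⟨ordConnected_Icc, fun s hs t ht => ?_⟩, by simpa using h1, by simpa using h0⟩
  have := hq (T - s) ⟨by linarith [hs.2], by linarith [hs.1]⟩ (T - t)
    ⟨by linarith [ht.2], by linarith [ht.1]⟩
  rwa [show T - s - (T - t) = -(s - t) by ring, abs_neg] at this

/-- Starting far from the image of a contracting map, a quasigeodesic that ends on the image comes
back, and the projection of this excursion is short compared to its length. -/
theorem IsQuasigeodesicFromTo.exists_return (hself : ∀ x, d x x = 0)
    (htri : ∀ x y z, d x z ≤ d x y + d y z) {q R K : ℝ}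
    {p : Y → Y} (hp : ∀ a b, R ≤ d (p a) (p b) → d a (p a) ≤ d a b + K) {γ : ℝ → Y} {T : ℝ}
    {x y : Y} (hγ : IsQuasigeodesicFromTo d q γ T x y) (hy : p y = y) {h E : ℝ} (hh : 0 < h)
    (hE : 0 ≤ E) (hhE : q * h + q + K ≤ E) (hq : 0 ≤ q) {s : ℝ} (hs : s ∈ Icc 0 T)
    (hsE : E < d (γ s) (p (γ s))) :
    ∃ i : ℕ, ∃ t ∈ Icc s T, d (γ t) (p (γ t)) ≤ E ∧ d (p (γ s)) (p (γ t)) ≤ i * R ∧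
      ((i : ℝ) - 1) * h ≤ t - s ∧ t - s ≤ i * h := by
  classical
  obtain ⟨hT, ⟨-, hqg⟩, -, h1⟩ := hγ
  have hend : d (γ T) (p (γ T)) ≤ E := by rw [h1, hy, hself]; exact hE
  -- Sample times with step `h`, clipped at `T`; the first sample near the image ends the excursion.
  set g : ℕ → ℝ := fun i => min (s + i * h) T with hg
  have hgI : ∀ i, g i ∈ Icc s T := fun i =>
    ⟨le_min (le_add_of_nonneg_right (by positivity)) hs.2, min_le_right _ _⟩
  have hgI' : ∀ i, g i ∈ Icc 0 T := fun i => ⟨hs.1.trans (hgI i).1, (hgI i).2⟩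
  have hex : ∃ i, d (γ (g i)) (p (γ (g i))) ≤ E := by
    obtain ⟨i, hi⟩ := exists_nat_gt ((T - s) / h)
    rw [div_lt_iff₀ hh] at hi
    exact ⟨i, by rwa [show g i = T from min_eq_right (by linarith)]⟩
  have hg0 : g 0 = s := by simp [hg, hs.2]
  have hmin : ∀ j < Nat.find hex, E < d (γ (g j)) (p (γ (g j))) :=
    fun j hj => not_le.1 (Nat.find_min hex hj)
  have hstep : ∀ j ≤ Nat.find hex, d (p (γ s)) (p (γ (g j))) ≤ j * R := by
    intro j
    induction j with
    | zero => intro _; rw [hg0, hself]; simp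
    | succ j ih =>
      intro hj
      have h2 := (hqg (g j) (hgI' j) (g (j + 1)) (hgI' (j + 1))).2
      have h3 : |g j - g (j + 1)| ≤ h := by
        have := abs_min_sub_min_le_max (s + j * h) T (s + ((j + 1 : ℕ) : ℝ) * h) T
        refine this.trans ?_
        rw [sub_self, abs_zero, max_eq_left (abs_nonneg _)]
        push_cast
        rw [show s + j * h - (s + (j + 1) * h) = -h by ring, abs_neg, abs_of_pos hh]
      -- A jump of the projection by more than `R` would, by contraction, put the earlier sample
      -- within `q * h + q + K ≤ E` of its projection.
      have h4 : d (p (γ (g j))) (p (γ (g (j + 1)))) ≤ R := by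
        by_contra hcon
        have := hp _ _ (not_le.1 hcon).le
        have h5 : q * |g j - g (j + 1)| ≤ q * h := by gcongr
        linarith [hmin j (by omega)]
      push_cast
      linarith [ih (by omega), htri (p (γ s)) (p (γ (g j))) (p (γ (g (j + 1))))]
  refine ⟨Nat.find hex, g (Nat.find hex), hgI _, Nat.find_spec hex, hstep _ le_rfl, ?_, ?_⟩
  · have hpos : Nat.find hex ≠ 0 := fun h0 => by
      have := Nat.find_spec hex
      rw [h0, hg0] at this
      linarith
    obtain ⟨j, hj⟩ := Nat.exists_eq_succ_of_ne_zero hpos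
    have hjT : s + j * h < T := by
      by_contra hcon
      have := hmin j (by omega)
      rw [show g j = T from min_eq_right (not_lt.1 hcon)] at this
      linarith
    have : s + j * h ≤ g (Nat.find hex) := le_min (by rw [hj]; push_cast; nlinarith) hjT.le
    rw [hj] at this ⊢
    push_cast
    linarith
  · have := min_le_left (s + (Nat.find hex : ℝ) * h) T
    simp only [hg]; linarith

/-- Quasigeodesics with endpoints on the image of a contracting map stay close to the image. -/
theorem exists_dist_le_of_contracting (hself : ∀ x, d x x = 0) (hcomm : ∀ x y, d x y = d y x)
    (htri : ∀ x y z, d x z ≤ d x y + d y z) {q R K : ℝ} (hq : 1 ≤ q) (hR : 0 ≤ R) (hK : 0 ≤ K) :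
    ∃ δ, 0 ≤ δ ∧ ∀ p : Y → Y, (∀ a b, R ≤ d (p a) (p b) → d a (p a) ≤ d a b + K) →
      ∀ (γ : ℝ → Y) (T : ℝ) (x y : Y), IsQuasigeodesicFromTo d q γ T x y → p x = x → p y = y →
        ∀ s ∈ Icc 0 T, d (γ s) (p (γ s)) ≤ δ := by
  -- With this step length, an excursion of `i + j` steps advances `d` by about `(i + j) * (2 * R +
  -- 1)`, while its projection moves at most `(i + j) * R`. Comparing the two bounds `(i + j) * (R +
  -- 1)` by `B`.
  set h := q * (2 * R + 1) with hh
  have hh0 : 0 < h := by positivity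
  set E := q * h + q + K with hE
  have hE0 : 0 ≤ E := by positivity
  set B := 2 * E + q + 4 * R + 2 with hB
  have hB0 : 0 ≤ B := by positivity
  refine ⟨E + (q * (B * h) + q + B * R), by positivity, fun p hp γ T x y hγ hx hy s hs => ?_⟩
  by_cases hsE : d (γ s) (p (γ s)) ≤ E
  · have : 0 ≤ q * (B * h) + q + B * R := by positivity
    linarith
  push Not at hsE
  -- The excursion containing `s` is followed forwards to `t` and, on the reversed path, backwards
  -- to `T - u`.
  obtain ⟨i, t, ht, htE, htp, hti, hti'⟩ := hγ.exists_return hself htri hp hy hh0 hE0 le_rfl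
    (by linarith) hs hsE
  obtain ⟨j, u, hu, huE, hup, huj, -⟩ := hγ.reverse.exists_return hself htri hp hx hh0 hE0 le_rfl
    (by linarith) (s := T - s) ⟨by linarith [hs.2], by linarith [hs.1]⟩ (by simpa using hsE)
  simp only [sub_sub_cancel] at huE hup
  obtain ⟨hT, ⟨-, hqg⟩, -, -⟩ := hγ
  have ht' : t ∈ Icc 0 T := ⟨hs.1.trans ht.1, ht.2⟩
  have hu' : T - u ∈ Icc 0 T := ⟨by linarith [hu.2], by linarith [hu.1, hs.2]⟩
  have hlow := (hqg (T - u) hu' t ht').1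
  have hup' := (hqg s hs t ht').2
  have hlen : t - (T - u) ≤ |T - u - t| := by rw [abs_sub_comm]; exact le_abs_self _
  have hlen' : ((i : ℝ) + j - 2) * (2 * R + 1) ≤ |T - u - t| / q := by
    rw [le_div_iff₀ (by linarith)]
    have : ((i : ℝ) + j - 2) * (2 * R + 1) * q = (i - 1) * h + (j - 1) * h := by rw [hh]; ring
    rw [this]; linarith
  have c1 := htri (γ (T - u)) (p (γ (T - u))) (γ t)
  have c2 := htri (p (γ (T - u))) (p (γ s)) (γ t)
  have c3 := htri (p (γ s)) (p (γ t)) (γ t)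
  rw [hcomm (p (γ t)) (γ t)] at c3
  rw [hcomm (p (γ (T - u))) (p (γ s))] at c2
  have hn : ((i : ℝ) + j) * (R + 1) ≤ B := by rw [hB]; linarith
  have hj0 : (0 : ℝ) ≤ j := Nat.cast_nonneg j
  have hi0 : (0 : ℝ) ≤ i := Nat.cast_nonneg i
  have hiB : (i : ℝ) ≤ B := by nlinarith [mul_nonneg (add_nonneg hi0 hj0) hR]
  have habs : |s - t| ≤ B * h := by
    rw [abs_sub_comm, abs_of_nonneg (by linarith [ht.1])]
    exact hti'.trans (by gcongr)
  have h6 : q * |s - t| ≤ q * (B * h) := by gcongr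
  have h7 : (i : ℝ) * R ≤ B * R := by gcongr
  have d1 := htri (γ s) (γ t) (p (γ s))
  have d2 := htri (γ t) (p (γ t)) (p (γ s))
  rw [hcomm (p (γ t)) (p (γ s))] at d2
  linarith

end Morse

/-! ### Hyperbolicity of the curtain metric. -/

section Hyperbolicity

variable {X : Type*} [MetricSpace X] [CAT0Space X]

/-- Conversely, a geodesic is close to a quasigeodesic that stays close to it. -/
theorem IsClosedGeodesic.exists_curtainDist_quasigeodesic_le {L : ℕ} {α : ℝ → X} {x y : X}
    (h : IsClosedGeodesic α (Icc 0 (dist x y))) (h0 : α 0 = x) (h1 : α (dist x y) = y) {q δ T : ℝ}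
    (hq : 0 ≤ q) (hδ : 0 ≤ δ) {γ : ℝ → X}
    (hγ : IsQuasigeodesicFromTo (curtainDist L) q γ T x y)
    (hclose : ∀ s ∈ Icc 0 T,
      curtainDist L (γ s) (α (foot α (Icc 0 (dist x y)) (γ s))) ≤ δ) {τ : ℝ}
    (hτ : τ ∈ Icc 0 (dist x y)) :
    ∃ t ∈ Icc 0 T, curtainDist L (α τ) (γ t) ≤ 3 * δ + 2 * q + (6 * L + 34) := by
  classical
  obtain ⟨hT, ⟨-, hqg⟩, g0, g1⟩ := hγ
  set F : ℝ → ℝ := fun s => foot α (Icc 0 (dist x y)) (γ s) with hF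
  have F0 : F 0 = 0 := by
    have := h.foot_apply (left_mem_Icc.2 dist_nonneg)
    rw [h0] at this
    simp only [hF]
    rwa [g0]
  have FT : F T = dist x y := by
    have := h.foot_apply (right_mem_Icc.2 dist_nonneg)
    rw [h1] at this
    simp only [hF]
    rwa [g1]
  set g : ℕ → ℝ := fun i => min (i : ℝ) T with hg
  have hgI : ∀ i, g i ∈ Icc 0 T := fun i => ⟨le_min (Nat.cast_nonneg i) hT, min_le_right _ _⟩
  have hex : ∃ i, τ ≤ F (g i) := by
    obtain ⟨i, hi⟩ := exists_nat_ge T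
    exact ⟨i, by rw [show g i = T from min_eq_right hi, FT]; exact hτ.2⟩
  have hspec := Nat.find_spec hex
  -- The point `α τ` lies between the feet of two consecutive unit-time samples. These feet are
  -- within `2 * δ + 2 * q` of each other, so additivity places `α τ` near the first.
  have hmin : ∀ j < Nat.find hex, F (g j) < τ := fun j hj => not_le.1 (Nat.find_min hex hj)
  rcases Nat.eq_zero_or_pos (Nat.find hex) with hi | hi
  · rw [hi, show g 0 = 0 by simp [hg, hT], F0] at hspec
    have : τ = 0 := le_antisymm hspec hτ.1
    refine ⟨0, left_mem_Icc.2 hT, ?_⟩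
    rw [this, h0, g0, curtainDist_self]
    positivity
  · obtain ⟨j, hj⟩ := Nat.exists_eq_succ_of_ne_zero hi.ne'
    rw [hj] at hspec
    have hjτ := hmin j (by omega)
    refine ⟨g j, hgI j, ?_⟩
    have e1 := (hqg (g j) (hgI j) (g (j + 1)) (hgI (j + 1))).2
    have e2 : |g j - g (j + 1)| ≤ 1 := by
      have := abs_min_sub_min_le_max (j : ℝ) T ((j + 1 : ℕ) : ℝ) T
      refine this.trans ?_
      rw [sub_self, abs_zero, max_eq_left (abs_nonneg _)]
      simp
    have e3 : q * |g j - g (j + 1)| ≤ q * 1 := by gcongr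
    have e4 := hclose _ (hgI j)
    have e5 := hclose _ (hgI (j + 1))
    have e6 := h.isGeodesicOn.curtainDist_add_le L (h.foot_mem (γ (g j)))
      (h.foot_mem (γ (g (j + 1)))) hjτ.le hspec
    have t1 := curtainDist_triangle L (α (F (g j))) (γ (g j)) (α (F (g (j + 1))))
    have t2 := curtainDist_triangle L (γ (g j)) (γ (g (j + 1))) (α (F (g (j + 1))))
    have t3 := curtainDist_triangle L (α τ) (α (F (g j))) (γ (g j))
    rw [curtainDist_comm L (α τ) (α (F (g j)))] at t3
    rw [curtainDist_comm L (α (F (g j))) (γ (g j))] at t1 t3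
    have t4 := curtainDist_nonneg L (α τ) (α (F (g (j + 1))))
    linarith

/-- Each quasigeodesic side is close to the CAT(0) geodesic with the same endpoints, in both
directions, so thinness passes over from the CAT(0) triangle. -/
theorem isHyperbolic_curtainDist (L : ℕ) : IsHyperbolic (curtainDist (X := X) L) := by
  intro q hq
  have hL : (0 : ℝ) ≤ L := Nat.cast_nonneg L
  obtain ⟨δ, hδ, hmorse⟩ := exists_dist_le_of_contracting (curtainDist_self (X := X) L)
    (curtainDist_comm L) (curtainDist_triangle L) (q := q) (R := 9 * L + 50) (K := 22 * L + 121) hq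
    (by positivity) (by positivity)
  have close : ∀ {x y : X} {α : ℝ → X}, IsClosedGeodesic α (Icc 0 (dist x y)) → α 0 = x →
      α (dist x y) = y → ∀ {γ : ℝ → X} {T : ℝ}, IsQuasigeodesicFromTo (curtainDist L) q γ T x y →
      ∀ s ∈ Icc 0 T, curtainDist L (γ s) (α (foot α (Icc 0 (dist x y)) (γ s))) ≤ δ := by
    intro x y α hα h0 h1 γ T hγ s hs
    refine hmorse (fun z => α (foot α (Icc 0 (dist x y)) z)) (fun a b => hα.curtainDist_foot_le)
      γ T x y hγ ?_ ?_ s hs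
    · have := hα.foot_apply (left_mem_Icc.2 dist_nonneg)
      rw [h0] at this
      simp only [this, h0]
    · have := hα.foot_apply (right_mem_Icc.2 dist_nonneg)
      rw [h1] at this
      simp only [this, h1]
  refine ⟨δ + ((16 * L + 87) + (3 * δ + 2 * q + (6 * L + 34))),
    fun x y z γ₁ γ₂ γ₃ T₁ T₂ T₃ hγ₁ hγ₂ hγ₃ s hs => ?_⟩
  obtain ⟨α, hα, a0, a1⟩ := CAT0Space.exists_isGeodesicOn x y
  obtain ⟨β, hβ, b0, b1⟩ := CAT0Space.exists_isGeodesicOn y z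
  obtain ⟨η, hη, e0, e1⟩ := CAT0Space.exists_isGeodesicOn z x
  have hs' := close hα a0 a1 hγ₁ s hs
  rcases exists_curtainDist_le_of_triangle L hα a0 a1 hβ b0 b1 hη e0 e1 (hα.foot_mem (γ₁ s)) with
    ⟨t, ht, htd⟩ | ⟨t, ht, htd⟩
  · left
    obtain ⟨u, hu, hud⟩ := hβ.exists_curtainDist_quasigeodesic_le b0 b1 (by linarith) hδ hγ₂
      (close hβ b0 b1 hγ₂) ht
    refine ⟨u, hu, ?_⟩
    linarith [curtainDist_triangle L (γ₁ s) (α (foot α (Icc 0 (dist x y)) (γ₁ s))) (γ₂ u),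
      curtainDist_triangle L (α (foot α (Icc 0 (dist x y)) (γ₁ s))) (β t) (γ₂ u)]
  · right
    obtain ⟨u, hu, hud⟩ := hη.exists_curtainDist_quasigeodesic_le e0 e1 (by linarith) hδ hγ₃
      (close hη e0 e1 hγ₃) ht
    refine ⟨u, hu, ?_⟩
    linarith [curtainDist_triangle L (γ₁ s) (α (foot α (Icc 0 (dist x y)) (γ₁ s))) (γ₃ u),
      curtainDist_triangle L (α (foot α (Icc 0 (dist x y)) (γ₁ s))) (η t) (γ₃ u)]

end Hyperbolicity

/-! ### Geodesics as unparametrised quasigeodesics. -/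

section Reparametrisation

/-- A coarsely additive coarse distance on a set of reals is, up to a bounded error, the distance
in some continuous increasing coordinate. -/
theorem exists_strictMonoOn_of_coarselyAdditive {I : Set ℝ} {ρ : ℝ → ℝ → ℝ} {B C : ℝ}
    (hB : 0 ≤ B) (hC : 0 ≤ C) (hnonneg : ∀ s t, 0 ≤ ρ s t) (hcomm : ∀ s t, ρ s t = ρ t s)
    (htri : ∀ s t u, ρ s u ≤ ρ s t + ρ t u)
    (hle : ∀ s ∈ I, ∀ t ∈ I, s ≤ t → ρ s t ≤ t - s + B)
    (hadd : ∀ s ∈ I, ∀ t ∈ I, ∀ u ∈ I, s ≤ t → t ≤ u → ρ s t + ρ t u ≤ ρ s u + C) :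
    ∃ f : ℝ → ℝ, ContinuousOn f I ∧ StrictMonoOn f I ∧ ∀ s ∈ I, ∀ t ∈ I,
      |f s - f t| ≤ ρ s t + (2 * C + B + 4) ∧ ρ s t ≤ |f s - f t| + (2 * C + B + 4) := by
  rcases I.eq_empty_or_nonempty with rfl | ⟨o, ho⟩
  · exact ⟨id, continuousOn_id, strictMono_id.strictMonoOn _, fun s hs => hs.elim⟩
  -- Signed distance from a base point: by additivity its increments equal `ρ` up to `C`, but it
  -- need be neither monotone nor continuous.
  set g : ℝ → ℝ := fun t => if o ≤ t then ρ o t else -ρ o t with hg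
  have hgd : ∀ s ∈ I, ∀ t ∈ I, s ≤ t → ρ s t - C ≤ g t - g s ∧ g t - g s ≤ ρ s t + C := by
    intro s hs t ht hst
    rcases le_or_gt o s with h1 | h1
    · have e1 : g s = ρ o s := if_pos h1
      have e2 : g t = ρ o t := if_pos (h1.trans hst)
      rw [e1, e2]
      constructor <;> linarith [htri o s t, hadd o ho s hs t ht h1 hst]
    · have e1 : g s = -ρ o s := if_neg (not_le.2 h1)
      rcases le_or_gt o t with h2 | h2
      · have e2 : g t = ρ o t := if_pos h2
        rw [e1, e2]
        constructor <;> linarith [htri s o t, hadd s hs o ho t ht h1.le h2, hcomm s o]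
      · have e2 : g t = -ρ o t := if_neg (not_le.2 h2)
        rw [e1, e2]
        constructor <;>
          linarith [htri s t o, hadd s hs t ht o ho hst h2.le, hcomm s o, hcomm t o]
  have : Nonempty I := ⟨⟨o, ho⟩⟩
  -- a monotone Lipschitz regularisation of `g`
  set f₀ : ℝ → ℝ := fun t => ⨅ s : I, (g s + max (t - s) 0) with hf₀
  -- Increments of `g` are at least `-C`, and at most the increment of the parameter plus `B + C`;
  -- so the regularisation stays within `C + B` of `g`.
  have hlow : ∀ t ∈ I, ∀ s : I, g t - C - B ≤ g s + max (t - s) 0 := by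
    intro t ht s
    rcases le_total (s : ℝ) t with h | h
    · linarith [(hgd s s.2 t ht h).2, hle s s.2 t ht h, le_max_left (t - s) 0]
    · linarith [(hgd t ht s s.2 h).1, hnonneg t s, le_max_right (t - s) 0]
  have hbdd : ∀ t ∈ I, BddBelow (range fun s : I => g s + max (t - s) 0) := fun t ht =>
    ⟨g t - C - B, by rintro _ ⟨s, rfl⟩; exact hlow t ht s⟩
  have hf₀low : ∀ t ∈ I, g t - C - B ≤ f₀ t := fun t ht => le_ciInf (hlow t ht)
  have hf₀up : ∀ t ∈ I, f₀ t ≤ g t := fun t ht =>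
    (ciInf_le (hbdd t ht) ⟨t, ht⟩).trans (by simp)
  have hmono : ∀ s ∈ I, ∀ t ∈ I, s ≤ t → f₀ s ≤ f₀ t := fun s hs t ht hst =>
    ciInf_mono (hbdd s hs) fun u => by gcongr
  have hlip : ∀ s ∈ I, ∀ t ∈ I, s ≤ t → f₀ t ≤ f₀ s + (t - s) := by
    intro s hs t ht hst
    have : f₀ t - (t - s) ≤ f₀ s := le_ciInf fun u => by
      have h1 := ciInf_le (hbdd t ht) u
      have h2 : max (t - u) 0 ≤ max (s - u) 0 + (t - s) :=
        max_le (by linarith [le_max_left (s - (u : ℝ)) 0])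
          (by linarith [le_max_right (s - (u : ℝ)) 0])
      change f₀ t ≤ _ at h1
      linarith
    linarith
  have hcont : ContinuousOn f₀ I := by
    have : LipschitzOnWith 1 f₀ I := LipschitzOnWith.of_dist_le_mul fun s hs t ht => by
      rw [Real.dist_eq, Real.dist_eq, NNReal.coe_one, one_mul]
      rcases le_total s t with h | h
      · rw [abs_sub_comm, abs_sub_comm s t, abs_of_nonneg (by linarith [hmono s hs t ht h]),
          abs_of_nonneg (by linarith)]
        linarith [hlip s hs t ht h]
      · rw [abs_of_nonneg (by linarith [hmono t ht s hs h]), abs_of_nonneg (by linarith)]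
        linarith [hlip t ht s hs h]
    exact this.continuousOn
  -- Adding the arctangent makes the coordinate strictly increasing and changes differences by less
  -- than `π ≤ 4`.
  have hstrict : StrictMonoOn (fun t => f₀ t + Real.arctan t) I := fun s hs t ht hst =>
    add_lt_add_of_le_of_lt (hmono s hs t ht hst.le) (Real.arctan_strictMono hst)
  have main : ∀ s ∈ I, ∀ t ∈ I, s ≤ t →
      |f₀ s + Real.arctan s - (f₀ t + Real.arctan t)| ≤ ρ s t + (2 * C + B + 4) ∧
      ρ s t ≤ |f₀ s + Real.arctan s - (f₀ t + Real.arctan t)| + (2 * C + B + 4) := by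
    intro s hs t ht hst
    have a1 := Real.arctan_lt_pi_div_two s
    have a2 := Real.arctan_lt_pi_div_two t
    have a3 := Real.neg_pi_div_two_lt_arctan s
    have a4 := Real.neg_pi_div_two_lt_arctan t
    have a5 := Real.pi_le_four
    have b := hgd s hs t ht hst
    have c1 := hf₀low s hs
    have c2 := hf₀up s hs
    have c3 := hf₀low t ht
    have c4 := hf₀up t ht
    have e := hstrict.monotoneOn hs ht hst
    rw [abs_sub_comm, abs_of_nonneg (by linarith)]
    constructor <;> linarith
  refine ⟨fun t => f₀ t + Real.arctan t, hcont.add Real.continuous_arctan.continuousOn, hstrict,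
    fun s hs t ht => ?_⟩
  rcases le_total s t with h | h
  · exact main s hs t ht h
  · have := main t ht s hs h
    rwa [abs_sub_comm, hcomm t s] at this

variable {X : Type*} [MetricSpace X] [CAT0Space X]

/-- After a continuous increasing change of the parameter, a geodesic is a quasigeodesic of the
curtain metric, with a constant that depends only on `L`. -/
theorem IsGeodesicOn.exists_reparametrisation (L : ℕ) {α : ℝ → X} {I : Set ℝ}
    (hα : IsGeodesicOn α I) : ∃ f φ : ℝ → ℝ, ContinuousOn f I ∧ StrictMonoOn f I ∧
      (∀ s ∈ I, φ (f s) = s) ∧ IsQuasigeodesicOn (curtainDist L) (12 * L + 75) (α ∘ φ) (f '' I) := by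
  have hL : (0 : ℝ) ≤ L := Nat.cast_nonneg L
  -- The error `2 * C + B + 4` comes to `12 * L + 75`.
  obtain ⟨f, hc, hm, hf⟩ := exists_strictMonoOn_of_coarselyAdditive (I := I)
    (ρ := fun s t => curtainDist L (α s) (α t)) (B := 3) (C := 6 * L + 34) (by norm_num)
    (by positivity) (fun _ _ => curtainDist_nonneg _ _ _) (fun _ _ => curtainDist_comm _ _ _)
    (fun _ _ _ => curtainDist_triangle _ _ _ _)
    (fun s hs t ht hst => by
      rw [← hα.dist_eq hs ht hst]; exact curtainDist_le_dist _ _ _)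
    (fun s hs t _ u hu hst htu => hα.curtainDist_add_le L hs hu hst htu)
  have hφ : ∀ s ∈ I, Function.invFunOn f I (f s) = s := hm.injOn.leftInvOn_invFunOn
  refine ⟨f, Function.invFunOn f I, hc, hm, hφ, (hα.1.isPreconnected.image f hc).ordConnected, ?_⟩
  rintro _ ⟨s, hs, rfl⟩ _ ⟨t, ht, rfl⟩
  rw [Function.comp_apply, Function.comp_apply, hφ s hs, hφ t ht]
  obtain ⟨h1, h2⟩ := hf s hs t ht
  have h3 : |f s - f t| / (12 * L + 75) ≤ |f s - f t| :=
    div_le_self (abs_nonneg _) (by linarith)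
  have h4 : |f s - f t| ≤ (12 * L + 75) * |f s - f t| :=
    le_mul_of_one_le_left (abs_nonneg _) (by linarith)
  constructor <;> linarith

theorem IsGeodesicOn.isUnparametrisedQuasigeodesicOn (L : ℕ) {α : ℝ → X} {I : Set ℝ}
    (hα : IsGeodesicOn α I) :
    IsUnparametrisedQuasigeodesicOn (curtainDist L) (12 * L + 75) α I := by
  obtain ⟨f, φ, -, hm, hφ, hq⟩ := hα.exists_reparametrisation L
  refine ⟨f '' I, φ, ?_, ?_, hq⟩
  · rintro _ ⟨s, hs, rfl⟩ _ ⟨t, ht, rfl⟩ hst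
    rw [hφ s hs, hφ t ht]
    exact (hm.lt_iff_lt hs ht).1 hst
  · rw [image_image]
    exact (image_congr hφ).trans (image_id' I)

theorem isQuasigeodesicSpace_curtainDist (L : ℕ) :
    IsQuasigeodesicSpace (curtainDist (X := X) L) := by
  refine ⟨12 * L + 75, by linarith [Nat.cast_nonneg (α := ℝ) L], fun x y => ?_⟩
  obtain ⟨α, hα, h0, h1⟩ := CAT0Space.exists_isGeodesicOn x y
  obtain ⟨f, φ, hc, hm, hφ, -, hq⟩ := hα.isGeodesicOn.exists_reparametrisation L
  have hl := left_mem_Icc.2 (dist_nonneg (x := x) (y := y))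
  have hr := right_mem_Icc.2 (dist_nonneg (x := x) (y := y))
  -- Continuity of `f` makes its image a full interval, so after a translation the parameters fill a
  -- compact interval from 0.
  have himg : ∀ t ∈ Icc 0 (f (dist x y) - f 0), t + f 0 ∈ f '' Icc 0 (dist x y) := fun t ht =>
    intermediate_value_Icc dist_nonneg hc ⟨by linarith [ht.1], by linarith [ht.2]⟩
  refine ⟨fun t => (α ∘ φ) (t + f 0), f (dist x y) - f 0,
    sub_nonneg.2 (hm.monotoneOn hl hr dist_nonneg), ⟨ordConnected_Icc, fun s hs t ht => ?_⟩, ?_, ?_⟩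
  · have := hq _ (himg s hs) _ (himg t ht)
    rwa [add_sub_add_right_eq_sub] at this
  · simp only [Function.comp_apply, zero_add, hφ 0 hl, h0]
  · simp only [Function.comp_apply, sub_add_cancel, hφ _ hr, h1]

end Reparametrisation

theorem mainTheorem1 {X : Type*} [MetricSpace X] [CAT0Space X] (L : ℕ) :
    -- the maxima defining `d_L` exist, and `d_L` is a metric
    (∀ x y : X, BddAbove (separatingLengths L x y)) ∧
    IsMetric (curtainDist (X := X) L) ∧
    -- `X_L` is a quasigeodesic hyperbolic space
    IsQuasigeodesicSpace (curtainDist (X := X) L) ∧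
    IsHyperbolic (curtainDist (X := X) L) ∧
    -- `Isom X ≤ Isom X_L`
    isometryGroup (fun x y : X => dist x y) ≤ isometryGroup (curtainDist (X := X) L) ∧
    -- the action of `Isom X` on `X_L` dominates the one on `X_{L-1}`
    (1 ≤ L → ActionDominates (isometryGroup (fun x y : X => dist x y))
      (curtainDist (X := X) L) (curtainDist (X := X) (L - 1))) ∧
    -- CAT(0) geodesics are uniform unparametrised quasigeodesics of `X_L`
    (∃ q : ℝ, 1 ≤ q ∧ ∀ (α : ℝ → X) (I : Set ℝ), IsGeodesicOn α I →
      IsUnparametrisedQuasigeodesicOn (curtainDist (X := X) L) q α I) := by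
  exact ⟨bddAbove_separatingLengths L, isMetric_curtainDist L, isQuasigeodesicSpace_curtainDist L,
    isHyperbolic_curtainDist L, isometryGroup_le_isometryGroup_curtainDist L,
    fun _ => actionDominates_curtainDist (Nat.sub_le L 1), 12 * L + 75,
    by linarith [Nat.cast_nonneg (α := ℝ) L], fun _ _ hα => hα.isUnparametrisedQuasigeodesicOn L⟩
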